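/- **Proposition 2.1.** Let $\Xi=\{(x,n)\in\mathbb Z\times\mathbb Z_{\ge 0}: |x|+n \text{ even}\}$ and let $E$ be the set of directed edges from $(x,n)\in\Xi$ to $(x\pm1,n+1)$. Let $\{X_e:e\in E\}$ be i.i.d. real random variables on a probability space $(\Omega,\mathcal F,P)$ with $E[X_e]=0$, satisfying the Cramér condition: there is $c_0>0$ such that $E[e^{cX_e}]<\infty$ for all $|c|<c_0$. For $\underline x\in\Xi$ at level $k\le n$, let $\aleph_n^{\underline x}$ be the set of directed paths $\underline\gamma$ in $(\Xi,E)$ from $\underline x$ to level $n$; the value of a path is $V(\underline\gamma)=\sum_{e\in\underline\gamma}X_e$. Let $Z_n=\sup\{V(\underline\gamma):\underline\gamma\in\aleph_n^{(0,0)}\}$. Then there is a (necessarily unique) constant $\mu\in\mathbb R$ with $Z_n/n\to\mu$ $P$-almost surely, and the following holds for this $\mu$. There is $\varepsilon_0>0$ such that for every $\varepsilon\in(0,\varepsilon_0)$ and every $\delta\in(0,1)$ there are $n_0\in\mathbb N$ and $c=c(\varepsilon,\delta)>0$ such that for all $n\ge n_0$ $$P\bigl(G_{\delta n,n}^c\bigr)\le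 e^{-cn^2},$$ where, with $B_{\delta,n}=\{(x,m)\in\Xi: m=\lfloor\delta n\rfloor,\ -\delta n/4<x<\delta n/4\}$, $$G_{\delta n,n}=\Bigl\{\#\bigl\{\underline x\in B_{\delta,n}:\ \exists\,\underline\gamma\in\aleph_n^{\underline x},\ V(\underline\gamma)\ge(\mu-\varepsilon/10)(1-\delta)n\bigr\}\ \ge\ \tfrac{9}{10}\,\# B_{\delta,n}\Bigr\}.$$ -/

import Mathlib

open MeasureTheory ProbabilityTheory Filter Topology

namespace DirectedLattice

/-- The vertex set `Ξ` in dimension `d = 1`: the points `(x, n)` of `ℤ × ℤ₊` with `|x| + n` even. -/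
def Vertex : Type := {v : ℤ × ℕ // Even (|v.1| + (v.2 : ℤ))}

namespace Vertex

/-- The spatial coordinate `x` of `(x, n)`. -/
def space (v : Vertex) : ℤ := v.1.1

/-- The level `n` of `(x, n)`. -/
def level (v : Vertex) : ℕ := v.1.2

end Vertex

/-- The origin `(0, 0)` of `Ξ`. -/
def origin : Vertex := ⟨(0, 0), by simp⟩

/-- There is a directed edge from `v = (x, n)` to `w` when `w = (x ± 1, n + 1)`. -/
def IsEdge (v w : Vertex) : Prop :=
  w.level = v.level + 1 ∧ |w.space - v.space| = 1

/-- The set `E` of directed nearest neighbour edges. -/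
def Edge : Type := {e : Vertex × Vertex // IsEdge e.1 e.2}

/-- A directed nearest neighbour path with `L` steps. -/
structure Path (L : ℕ) where
  /-- The vertex visited at time `i`, for `0 ≤ i ≤ L`. -/
  vertex : Fin (L + 1) → Vertex
  /-- Consecutive vertices are joined by a directed edge. -/
  step : ∀ i : Fin L, IsEdge (vertex i.castSucc) (vertex i.succ)

/-- The `i`-th edge of a path. -/
def Path.edge {L : ℕ} (γ : Path L) (i : Fin L) : Edge :=
  ⟨(γ.vertex i.castSucc, γ.vertex i.succ), γ.step i⟩

/-- The value `V(γ)`, the sum of the weights of the edges of `γ`. -/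
noncomputable def Path.value {L : ℕ} (γ : Path L) (w : Edge → ℝ) : ℝ :=
  ∑ i : Fin L, w (γ.edge i)

/-- The paths from the vertex `v` (at a level at most `n`) to level `n`. -/
def pathsTo (v : Vertex) (n : ℕ) : Set (Path (n - v.level)) :=
  {γ | γ.vertex 0 = v}

/-- The last passage value `Z_n`: the largest value of a path from the origin to level `n`. -/
noncomputable def lastPassage (w : Edge → ℝ) (n : ℕ) : ℝ :=
  ⨆ γ : pathsTo origin n, γ.1.value w

/-- The block of all vertices `(x, m)` at level `m` with `-r < x < r`. -/
def block (m : ℕ) (r : ℝ) : Set Vertex :=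
  {v | v.level = m ∧ -r < (v.space : ℝ) ∧ (v.space : ℝ) < r}

/-- The vertices `v` of the block at level `⌊δ n⌋` with `|x| < δ n / 4` from which some path to
level `n` has value at least `(μ - ε / 10) (1 - δ) n`. -/
def goodStarts (w : Edge → ℝ) (μ ε δ : ℝ) (n : ℕ) : Set Vertex :=
  {v | v ∈ block ⌊δ * n⌋₊ (δ * n / 4) ∧
    ∃ γ ∈ pathsTo v n, (μ - ε / 10) * (1 - δ) * n ≤ γ.value w}

/-- The event that at least nine tenths of the vertices of the block are good starting points. -/
def goodEvent {Ω : Type*} (X : Edge → Ω → ℝ) (μ ε δ : ℝ) (n : ℕ) : Set Ω :=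
  {ω | (9 / 10 : ℝ) * ((block ⌊δ * n⌋₊ (δ * n / 4)).ncard : ℝ) ≤
    ((goodStarts (fun e => X e ω) μ ε δ n).ncard : ℝ)}

end DirectedLattice

/-!
A path with `L` steps is encoded by its starting vertex and a word of length `L` in two letters,
and `maxValue w v A` is the largest value of a path from `v` that follows a word of the finite set
`A`. The time constant is the supremum over `k` of the mean of `maxValue` over the paths of length
`2 * k` that return to their starting position, divided by `2 * k`.

*Upper bound for the passage time.* A path with `n` steps and displacement `y`, followed by the
mirror image of such a path, has displacement zero. As the law of the weights is invariant under
translations and reflections, the mean of the maximal value over the paths with displacement `y` is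
at most `n` times the time constant (`IsExpField.meanValue_le_timeConstant`). The maximal value is a
function of the `n` independent layers of weights, and depends on each layer in a Lipschitz way with
respect to the supremum norm, because a path crosses each layer once. A bounded-difference
inequality with unbounded differences (`integral_exp_sub_integral_le_pow`, proved by Jensen's
inequality and symmetrization, one layer at a time) then yields concentration with error
probability `exp (-c √n)`, which survives the union over the `O(n)` displacements.

*Lower bound for the passage time, and the good starting points.* If `k` is large, a path may
return to its axis every `2 * k` steps and lose at most `ε` per step. The maximal values of
consecutive blocks are independent and identically distributed with exponential moments, and
so are those of blocks in tubes whose axes are more than `4 * k` apart. A single Chernoff bound for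
all blocks of all tubes above a separated set `S` of starting points shows that the points of `S` all
fail with probability at most `exp (-κ L #S)`, where `L` is the number of steps
(`IsExpField.exists_measure_forall_wordValue_lt_le`). For `S` the origin this gives the law of large
numbers. If a tenth of a block of order `n` vertices fails, then so does a separated subset with
at least `c n` elements by the pigeonhole principle, which has probability at most `exp (-c n²)`; the
number of subsets of the block is only exponential in `n`.
-/

namespace DirectedLattice

/-! ### Words of steps and their values -/

theorem Vertex.eq_of {v w : Vertex} (hs : v.space = w.space) (hl : v.level = w.level) : v = w :=
  Subtype.ext (Prod.ext hs hl)

theorem Vertex.even_add (v : Vertex) : Even (v.space + (v.level : ℤ)) := by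
  have h := v.2
  simpa [Int.even_add, even_abs, Vertex.space, Vertex.level] using h

/-- The vertex `(x, n)`, with the parity condition stated without the absolute value. -/
def Vertex.of (x : ℤ) (n : ℕ) (h : Even (x + (n : ℤ))) : Vertex :=
  ⟨(x, n), by simpa [Int.even_add, even_abs] using h⟩

/-- The spatial increment of a step: `+1` for `true`, `-1` for `false`. -/
def stepSign (b : Bool) : ℤ := if b then 1 else -1

theorem stepSign_not (b : Bool) : stepSign (!b) = -stepSign b := by cases b <;> rfl

theorem abs_stepSign (b : Bool) : |stepSign b| = 1 := by cases b <;> rfl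

theorem odd_stepSign (b : Bool) : Odd (stepSign b) := by cases b <;> decide

/-- The vertex reached from `v` by one step in direction `b`. -/
def Vertex.next (v : Vertex) (b : Bool) : Vertex :=
  Vertex.of (v.space + stepSign b) (v.level + 1) (by
    obtain ⟨r, hr⟩ := v.even_add
    obtain ⟨s, hs⟩ := (odd_stepSign b).add_odd odd_one
    exact ⟨r + s, by push_cast; omega⟩)

@[simp] theorem Vertex.space_next (v : Vertex) (b : Bool) :
    (v.next b).space = v.space + stepSign b := rfl

@[simp] theorem Vertex.level_next (v : Vertex) (b : Bool) : (v.next b).level = v.level + 1 := rfl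

theorem isEdge_next (v : Vertex) (b : Bool) : IsEdge v (v.next b) :=
  ⟨rfl, by simp [abs_stepSign]⟩

theorem IsEdge.exists_next {v w : Vertex} (h : IsEdge v w) : ∃ b, w = v.next b := by
  obtain ⟨h1, h2⟩ := h
  rcases (abs_eq (zero_le_one)).1 h2 with h | h
  · exact ⟨true, Vertex.eq_of (by simp [stepSign]; omega) h1⟩
  · exact ⟨false, Vertex.eq_of (by simp [stepSign]; omega) h1⟩

/-- The edge that leaves `v` in direction `b`. -/
def outEdge (v : Vertex) (b : Bool) : Edge := ⟨(v, v.next b), isEdge_next v b⟩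

/-- The starting vertex of an edge. -/
def Edge.src (e : Edge) : Vertex := e.1.1

@[simp] theorem src_outEdge (v : Vertex) (b : Bool) : (outEdge v b).src = v := rfl

/-- The edges crossed by the path that starts at `v` and follows the word `l`. A path with `L`
steps is encoded by its starting vertex and a word of length `L`. -/
def wordEdges : Vertex → List Bool → List Edge
  | _, [] => []
  | v, b :: l => outEdge v b :: wordEdges (v.next b) l

/-- The last vertex of the path that starts at `v` and follows the word `l`. -/
def endpoint (v : Vertex) (l : List Bool) : Vertex := l.foldl Vertex.next v

/-- The total spatial displacement of a word. -/
def displacement (l : List Bool) : ℤ := (l.map stepSign).sum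

/-- The value of the path that starts at `v` and follows the word `l`. -/
def wordValue (w : Edge → ℝ) (v : Vertex) (l : List Bool) : ℝ := ((wordEdges v l).map w).sum

@[simp] theorem wordValue_nil (w : Edge → ℝ) (v : Vertex) : wordValue w v [] = 0 := rfl

@[simp] theorem wordValue_cons (w : Edge → ℝ) (v : Vertex) (b : Bool) (l : List Bool) :
    wordValue w v (b :: l) = w (outEdge v b) + wordValue w (v.next b) l := by
  simp [wordValue, wordEdges]

theorem wordValue_append (w : Edge → ℝ) (v : Vertex) (l l' : List Bool) :
    wordValue w v (l ++ l') = wordValue w v l + wordValue w (endpoint v l) l' := by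
  induction l generalizing v with
  | nil => simp [endpoint]
  | cons b l ih => simp [ih, endpoint, add_assoc]

theorem displacement_append (l l' : List Bool) :
    displacement (l ++ l') = displacement l + displacement l' := by
  simp [displacement]

theorem displacement_map_not (l : List Bool) : displacement (l.map not) = -displacement l := by
  induction l with
  | nil => rfl
  | cons b l ih =>
    simp only [displacement, List.map_cons, List.sum_cons] at ih ⊢
    rw [ih, stepSign_not]
    ring

theorem abs_displacement_le (l : List Bool) : |displacement l| ≤ l.length := by
  induction l with
  | nil => simp [displacement]
  | cons b l ih =>
    simp only [displacement, List.map_cons, List.sum_cons, List.length_cons] at ih ⊢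
    have := abs_add_le (stepSign b) (l.map stepSign).sum
    rw [abs_stepSign] at this
    push_cast
    linarith

theorem space_endpoint (v : Vertex) (l : List Bool) :
    (endpoint v l).space = v.space + displacement l := by
  induction l generalizing v with
  | nil => simp [endpoint, displacement]
  | cons b l ih =>
    have := ih (v.next b)
    simp only [endpoint, displacement, List.foldl_cons, List.map_cons, List.sum_cons,
      Vertex.space_next] at this ⊢
    rw [this]; ring

theorem level_endpoint (v : Vertex) (l : List Bool) :
    (endpoint v l).level = v.level + l.length := by
  induction l generalizing v with
  | nil => simp [endpoint]
  | cons b l ih =>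
    have := ih (v.next b)
    simp only [endpoint, List.foldl_cons, Vertex.level_next, List.length_cons] at this ⊢
    rw [this]; ring

theorem mem_wordEdges_bounds {v : Vertex} {l : List Bool} {e : Edge} (he : e ∈ wordEdges v l) :
    v.level ≤ e.src.level ∧ e.src.level < v.level + l.length ∧
      |e.src.space - v.space| ≤ l.length := by
  induction l generalizing v with
  | nil => simp [wordEdges] at he
  | cons b l ih =>
    rcases List.mem_cons.1 he with rfl | he
    · simp; positivity
    · obtain ⟨h1, h2, h3⟩ := ih he
      simp only [Vertex.level_next, Vertex.space_next, List.length_cons] at *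
      refine ⟨by omega, by omega, ?_⟩
      have := abs_add_le (e.src.space - (v.space + stepSign b)) (stepSign b)
      rw [abs_stepSign] at this
      rw [show e.src.space - v.space
        = e.src.space - (v.space + stepSign b) + stepSign b by ring]
      push_cast
      linarith

theorem nodup_wordEdges (v : Vertex) (l : List Bool) : (wordEdges v l).Nodup := by
  induction l generalizing v with
  | nil => simp [wordEdges]
  | cons b l ih =>
    refine List.nodup_cons.2 ⟨fun h => ?_, ih _⟩
    have := (mem_wordEdges_bounds h).1
    simp at this

theorem length_wordEdges (v : Vertex) (l : List Bool) : (wordEdges v l).length = l.length := by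
  induction l generalizing v with
  | nil => rfl
  | cons b l ih => simp [wordEdges, ih]

open Classical in
theorem wordValue_eq_sum (w : Edge → ℝ) (v : Vertex) (l : List Bool) :
    wordValue w v l = ∑ e ∈ (wordEdges v l).toFinset, w e :=
  (List.sum_toFinset w (nodup_wordEdges v l)).symm

theorem wordValue_congr {w w' : Edge → ℝ} {v : Vertex} {l : List Bool}
    (h : ∀ e ∈ wordEdges v l, w e = w' e) : wordValue w v l = wordValue w' v l := by
  unfold wordValue
  rw [List.map_congr_left h]

/-- A path crosses each level only once, so changing the weights of a single level by at most `D`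
changes its value by at most `D`. -/
theorem abs_wordValue_sub_le {w w' : Edge → ℝ} {v : Vertex} {l : List Bool} {D : ℝ} (i : ℕ)
    (hD : 0 ≤ D) (hne : ∀ e ∈ wordEdges v l, e.src.level ≠ i → w e = w' e)
    (heq : ∀ e ∈ wordEdges v l, |w e - w' e| ≤ D) :
    |wordValue w v l - wordValue w' v l| ≤ D := by
  induction l generalizing v with
  | nil => simpa using hD
  | cons b l ih =>
    simp only [wordValue_cons]
    have hmem : outEdge v b ∈ wordEdges v (b :: l) := List.mem_cons_self
    have hmem' : ∀ e ∈ wordEdges (v.next b) l, e ∈ wordEdges v (b :: l) :=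
      fun e he => List.mem_cons_of_mem _ he
    by_cases hi : v.level = i
    · have : wordValue w (v.next b) l = wordValue w' (v.next b) l := by
        refine wordValue_congr fun e he => hne e (hmem' e he) ?_
        have := (mem_wordEdges_bounds he).1
        simp at this
        omega
      rw [this, add_sub_add_right_eq_sub]
      exact heq _ hmem
    · rw [hne _ hmem hi, add_sub_add_left_eq_sub]
      exact ih (fun e he => hne e (hmem' e he)) (fun e he => heq e (hmem' e he))

/-! ### Paths and words -/

theorem Path.exists_word {L : ℕ} (γ : Path L) :
    ∃ l : List Bool, l.length = L ∧ ∀ w, wordValue w (γ.vertex 0) l = γ.value w := by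
  induction L with
  | zero => exact ⟨[], rfl, fun w => by simp [Path.value]⟩
  | succ L ih =>
    obtain ⟨l, hl, hv⟩ := ih ⟨fun i => γ.vertex i.succ, fun i => γ.step i.succ⟩
    obtain ⟨b, hb⟩ := (γ.step 0).exists_next
    refine ⟨b :: l, by simp [hl], fun w => ?_⟩
    have h0 : γ.edge 0 = outEdge (γ.vertex 0) b := Subtype.ext (Prod.ext rfl hb)
    have h1 : γ.vertex (Fin.succ 0) = (γ.vertex 0).next b := hb
    have h2 := hv w
    simp only [] at h2
    rw [wordValue_cons, ← h1, h2, Path.value, Path.value, Fin.sum_univ_succ, h0]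
    rfl

theorem exists_path (v : Vertex) (l : List Bool) :
    ∃ γ : Path l.length, γ.vertex 0 = v ∧ ∀ w, γ.value w = wordValue w v l := by
  induction l generalizing v with
  | nil => exact ⟨⟨fun _ => v, fun i => i.elim0⟩, rfl, fun w => by simp [Path.value]⟩
  | cons b l ih =>
    obtain ⟨γ, h0, hv⟩ := ih (v.next b)
    refine ⟨⟨Fin.cons v γ.vertex, ?_⟩, rfl, fun w => ?_⟩
    · intro i
      refine Fin.cases ?_ (fun j => ?_) i
      · simp only [Fin.castSucc_zero, Fin.cons_zero, Fin.cons_succ, h0]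
        exact isEdge_next v b
      · simpa only [← Fin.succ_castSucc, Fin.cons_succ] using γ.step j
    · rw [wordValue_cons, ← hv]
      refine (Fin.sum_univ_succ _).trans ?_
      congr 2
      exact Subtype.ext (Prod.ext rfl h0)

theorem exists_mem_pathsTo_iff (w : Edge → ℝ) (v : Vertex) (n : ℕ) (p : ℝ → Prop) :
    (∃ γ ∈ pathsTo v n, p (γ.value w)) ↔
      ∃ l : List Bool, l.length = n - v.level ∧ p (wordValue w v l) := by
  constructor
  · rintro ⟨γ, hγ, hp⟩
    obtain ⟨l, hl, hv⟩ := γ.exists_word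
    refine ⟨l, hl, ?_⟩
    have h : γ.vertex 0 = v := hγ
    rwa [← h, hv]
  · rintro ⟨l, hl, hp⟩
    suffices h : ∀ L, l.length = L → ∃ γ : Path L, γ.vertex 0 = v ∧ p (γ.value w) from h _ hl
    rintro L rfl
    obtain ⟨γ, h0, hv⟩ := exists_path v l
    exact ⟨γ, h0, by rwa [hv]⟩

/-- The words of length `n`. -/
noncomputable def words (n : ℕ) : Finset (List Bool) := (List.finite_length_eq Bool n).toFinset

@[simp] theorem mem_words {n : ℕ} {l : List Bool} : l ∈ words n ↔ l.length = n := by simp [words]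

theorem words_nonempty (n : ℕ) : (words n).Nonempty := ⟨List.replicate n true, by simp⟩

theorem card_words (n : ℕ) : (words n).card = 2 ^ n := by
  have h : ({l | l.length = n} : Set (List Bool)).ncard = Nat.card (List.Vector Bool n) := rfl
  rw [words, ← Set.ncard_eq_toFinset_card _ (List.finite_length_eq Bool n), h,
    Nat.card_eq_fintype_card]
  simp

/-- The largest value of a path that starts at `v` and follows a word of `A`. -/
noncomputable def maxValue (w : Edge → ℝ) (v : Vertex) (A : Finset (List Bool))
    (hA : A.Nonempty) : ℝ :=
  A.sup' hA (wordValue w v)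

theorem lastPassage_eq_maxValue (w : Edge → ℝ) (n : ℕ) :
    lastPassage w n = maxValue w origin (words n) (words_nonempty n) := by
  have hiff := exists_mem_pathsTo_iff w origin n
  have hub : ∀ γ : pathsTo origin n,
      γ.1.value w ≤ maxValue w origin (words n) (words_nonempty n) := by
    intro γ
    obtain ⟨l, hl, hv⟩ := (hiff (fun x => x = γ.1.value w)).1 ⟨γ.1, γ.2, rfl⟩
    rw [← hv]
    exact Finset.le_sup' (wordValue w origin) (mem_words.2 hl)
  obtain ⟨l, hl, hm⟩ := Finset.exists_mem_eq_sup' (words_nonempty n) (wordValue w origin)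
  obtain ⟨γ, hγ, hv⟩ := (hiff (fun x => x = wordValue w origin l)).2 ⟨l, mem_words.1 hl, rfl⟩
  have : Nonempty (pathsTo origin n) := ⟨⟨γ, hγ⟩⟩
  refine le_antisymm (ciSup_le hub) ?_
  rw [maxValue, hm, ← hv]
  exact le_ciSup (f := fun γ : pathsTo origin n => γ.1.value w)
    ⟨_, Set.forall_mem_range.2 hub⟩ ⟨γ, hγ⟩

/-! ### Symmetries -/

/-- The translate of `u` by `v`. -/
def Vertex.translate (v u : Vertex) : Vertex :=
  Vertex.of (v.space + u.space) (v.level + u.level) (by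
    obtain ⟨r, hr⟩ := v.even_add
    obtain ⟨s, hs⟩ := u.even_add
    exact ⟨r + s, by push_cast; omega⟩)

/-- The mirror image of a vertex with respect to the vertical axis. -/
def Vertex.reflect (u : Vertex) : Vertex :=
  Vertex.of (-u.space) u.level (by
    have := u.even_add
    simpa [Int.even_add] using this)

/-- The action of a translation on edges. -/
def Edge.translate (v : Vertex) (e : Edge) : Edge :=
  ⟨(v.translate e.1.1, v.translate e.1.2), by
    obtain ⟨h1, h2⟩ := e.2
    refine ⟨?_, ?_⟩
    · change v.level + _ = v.level + _ + 1
      omega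
    · change |v.space + e.1.2.space - (v.space + e.1.1.space)| = 1
      rwa [add_sub_add_left_eq_sub]⟩

/-- The action of the reflection on edges. -/
def Edge.reflect (e : Edge) : Edge :=
  ⟨(e.1.1.reflect, e.1.2.reflect), by
    obtain ⟨h1, h2⟩ := e.2
    refine ⟨h1, ?_⟩
    change |-e.1.2.space - -e.1.1.space| = 1
    rw [← h2, ← abs_neg]
    congr 1
    ring⟩

theorem Vertex.translate_injective (v : Vertex) : Function.Injective v.translate := by
  intro a b h
  have h1 : v.space + a.space = v.space + b.space := congrArg Vertex.space h
  have h2 : v.level + a.level = v.level + b.level := congrArg Vertex.level h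
  exact Vertex.eq_of (by omega) (by omega)

theorem Vertex.reflect_injective : Function.Injective Vertex.reflect := by
  intro a b h
  have h1 : -a.space = -b.space := congrArg Vertex.space h
  have h2 : a.reflect.level = b.reflect.level := congrArg Vertex.level h
  exact Vertex.eq_of (by omega) h2

theorem Edge.translate_injective (v : Vertex) : Function.Injective (Edge.translate v) := by
  intro a b h
  have h1 := congrArg (fun e : Edge => e.1.1) h
  have h2 := congrArg (fun e : Edge => e.1.2) h
  exact Subtype.ext (Prod.ext (v.translate_injective h1) (v.translate_injective h2))

theorem Edge.reflect_injective : Function.Injective Edge.reflect := by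
  intro a b h
  have h1 := congrArg (fun e : Edge => e.1.1) h
  have h2 := congrArg (fun e : Edge => e.1.2) h
  exact Subtype.ext (Prod.ext (Vertex.reflect_injective h1) (Vertex.reflect_injective h2))

theorem Vertex.translate_next (v u : Vertex) (b : Bool) :
    v.translate (u.next b) = (v.translate u).next b :=
  Vertex.eq_of (add_assoc _ _ _).symm (add_assoc _ _ _).symm

theorem Vertex.reflect_next (u : Vertex) (b : Bool) :
    (u.next b).reflect = u.reflect.next (!b) := by
  refine Vertex.eq_of ?_ rfl
  change -(u.space + stepSign b) = -u.space + stepSign (!b)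
  rw [stepSign_not]; ring

theorem wordValue_translate (w : Edge → ℝ) (v u : Vertex) (l : List Bool) :
    wordValue (fun e => w (e.translate v)) u l = wordValue w (v.translate u) l := by
  induction l generalizing u with
  | nil => rfl
  | cons b l ih =>
    rw [wordValue_cons, wordValue_cons, ih, Vertex.translate_next]
    congr 2
    exact Subtype.ext (Prod.ext rfl (Vertex.translate_next v u b))

theorem wordValue_reflect (w : Edge → ℝ) (u : Vertex) (l : List Bool) :
    wordValue (fun e => w e.reflect) u l = wordValue w u.reflect (l.map not) := by
  induction l generalizing u with
  | nil => rfl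
  | cons b l ih =>
    rw [List.map_cons, wordValue_cons, wordValue_cons, ih, Vertex.reflect_next]
    congr 2
    exact Subtype.ext (Prod.ext rfl (Vertex.reflect_next u b))

theorem translate_origin (v : Vertex) : v.translate origin = v :=
  Vertex.eq_of (add_zero _) (add_zero _)

theorem reflect_origin : origin.reflect = origin := Vertex.eq_of neg_zero rfl

theorem maxValue_eq_translate (w : Edge → ℝ) (v : Vertex) (A : Finset (List Bool))
    (hA : A.Nonempty) :
    maxValue w v A hA = maxValue (fun e => w (e.translate v)) origin A hA := by
  unfold maxValue
  congr 1
  ext l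
  rw [wordValue_translate, translate_origin]

/-! ### The maximal value over a set of words -/

theorem wordValue_le_maxValue (w : Edge → ℝ) (v : Vertex) {A : Finset (List Bool)}
    (hA : A.Nonempty) {l : List Bool} (hl : l ∈ A) : wordValue w v l ≤ maxValue w v A hA :=
  Finset.le_sup' (wordValue w v) hl

theorem exists_wordValue_eq_maxValue (w : Edge → ℝ) (v : Vertex) {A : Finset (List Bool)}
    (hA : A.Nonempty) : ∃ l ∈ A, maxValue w v A hA = wordValue w v l :=
  Finset.exists_mem_eq_sup' hA (wordValue w v)

theorem maxValue_singleton (w : Edge → ℝ) (v : Vertex) (l : List Bool) :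
    maxValue w v {l} (Finset.singleton_nonempty l) = wordValue w v l := by
  simp [maxValue]

@[fun_prop]
theorem measurable_wordValue (v : Vertex) (l : List Bool) :
    Measurable (fun w : Edge → ℝ => wordValue w v l) := by
  classical
  simp only [wordValue_eq_sum]
  fun_prop

@[fun_prop]
theorem measurable_maxValue (v : Vertex) (A : Finset (List Bool)) (hA : A.Nonempty) :
    Measurable (fun w : Edge → ℝ => maxValue w v A hA) := by
  have := Finset.measurable_sup' hA (f := fun l (w : Edge → ℝ) => wordValue w v l)
    (fun l _ => measurable_wordValue v l)
  convert this using 2 with w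
  simp [maxValue, Finset.sup'_apply]

open Classical in
/-- All edges crossed by the paths that start at `v` and follow a word of `A`. -/
noncomputable def edgeSet (v : Vertex) (A : Finset (List Bool)) : Finset Edge :=
  A.biUnion fun l => (wordEdges v l).toFinset

theorem mem_edgeSet {v : Vertex} {A : Finset (List Bool)} {e : Edge} :
    e ∈ edgeSet v A ↔ ∃ l ∈ A, e ∈ wordEdges v l := by
  simp [edgeSet]

theorem maxValue_congr {w w' : Edge → ℝ} {v : Vertex} {A : Finset (List Bool)} {hA : A.Nonempty}
    (h : ∀ e ∈ edgeSet v A, w e = w' e) : maxValue w v A hA = maxValue w' v A hA :=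
  Finset.sup'_congr hA rfl fun l hl =>
    wordValue_congr fun e he => h e (mem_edgeSet.2 ⟨l, hl, he⟩)

theorem abs_maxValue_sub_le {w w' : Edge → ℝ} {v : Vertex} {A : Finset (List Bool)}
    {hA : A.Nonempty} {D : ℝ}
    (h : ∀ l ∈ A, |wordValue w v l - wordValue w' v l| ≤ D) :
    |maxValue w v A hA - maxValue w' v A hA| ≤ D := by
  obtain ⟨l, hl, e⟩ := exists_wordValue_eq_maxValue w v hA
  obtain ⟨l', hl', e'⟩ := exists_wordValue_eq_maxValue w' v hA
  have h1 := abs_le.1 (h l hl)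
  have h2 := abs_le.1 (h l' hl')
  have h3 := wordValue_le_maxValue w v hA hl'
  have h4 := wordValue_le_maxValue w' v hA hl
  rw [abs_le]
  constructor <;> linarith [h1.1, h1.2, h2.1, h2.2]

theorem abs_wordValue_le (w : Edge → ℝ) {v : Vertex} {A : Finset (List Bool)} {l : List Bool}
    (hl : l ∈ A) : |wordValue w v l| ≤ ∑ e ∈ edgeSet v A, |w e| := by
  classical
  rw [wordValue_eq_sum]
  refine (Finset.abs_sum_le_sum_abs _ _).trans ?_
  refine Finset.sum_le_sum_of_subset_of_nonneg (fun e he => ?_) fun _ _ _ => abs_nonneg _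
  exact mem_edgeSet.2 ⟨l, hl, List.mem_toFinset.1 he⟩

theorem abs_maxValue_le (w : Edge → ℝ) (v : Vertex) (A : Finset (List Bool)) (hA : A.Nonempty) :
    |maxValue w v A hA| ≤ ∑ e ∈ edgeSet v A, |w e| := by
  obtain ⟨l, hl, e⟩ := exists_wordValue_eq_maxValue w v hA
  rw [e]
  exact abs_wordValue_le w hl

/-- The number of edges below level `n` that can be reached from the origin is at most
quadratic in `n`. -/
theorem card_edgeSet_origin_le {n : ℕ} {A : Finset (List Bool)} (hA : A ⊆ words n) :
    (edgeSet origin A).card ≤ n * (2 * n + 1) * 2 := by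
  let f : Edge → ℕ × ℤ × ℤ := fun e => (e.src.level, e.src.space, e.1.2.space - e.src.space)
  have hf : Function.Injective f := by
    intro a b h
    simp only [f, Prod.mk.injEq] at h
    obtain ⟨h1, h2, h3⟩ := h
    have h4 : a.1.2.level = a.src.level + 1 := a.2.1
    have h5 : b.1.2.level = b.src.level + 1 := b.2.1
    exact Subtype.ext (Prod.ext (Vertex.eq_of h2 h1) (Vertex.eq_of (by omega) (by omega)))
  have hmem : ∀ e ∈ edgeSet origin A,
      f e ∈ Finset.range n ×ˢ (Finset.Icc (-(n : ℤ)) n ×ˢ ({1, -1} : Finset ℤ)) := by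
    intro e he
    obtain ⟨l, hl, hel⟩ := mem_edgeSet.1 he
    obtain ⟨h1, h2, h3⟩ := mem_wordEdges_bounds hel
    rw [mem_words.1 (hA hl)] at h2 h3
    have h4 : |e.1.2.space - e.src.space| = 1 := e.2.2
    have h5 : origin.space = 0 := rfl
    have h6 : origin.level = 0 := rfl
    rw [h5, sub_zero, abs_le] at h3
    simp only [f, Finset.mem_product, Finset.mem_range, Finset.mem_Icc, Finset.mem_insert,
      Finset.mem_singleton]
    exact ⟨by omega, h3, (abs_eq zero_le_one).1 h4⟩
  have hcard := Finset.card_le_card_of_injOn f hmem hf.injOn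
  refine hcard.trans (le_of_eq ?_)
  simp only [Finset.card_product, Finset.card_range, Int.card_Icc]
  rw [show ((n : ℤ) + 1 - -(n : ℤ)).toNat = 2 * n + 1 by omega, ← mul_assoc]
  rfl

/-- The words of length `2 * k` with displacement zero. -/
noncomputable def zeroWords (k : ℕ) : Finset (List Bool) :=
  (words (2 * k)).filter fun l => displacement l = 0

theorem zeroWords_nonempty (k : ℕ) : (zeroWords k).Nonempty := by
  let l := List.replicate k true
  have hl : l.length = k := List.length_replicate
  refine ⟨l ++ l.map not, Finset.mem_filter.2 ⟨mem_words.2 ?_, ?_⟩⟩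
  · rw [List.length_append, List.length_map, hl]
    omega
  · rw [displacement_append, displacement_map_not, add_neg_cancel]

theorem length_of_mem_zeroWords {k : ℕ} {l : List Bool} (h : l ∈ zeroWords k) :
    l.length = 2 * k := mem_words.1 (Finset.mem_filter.1 h).1

theorem displacement_of_mem_zeroWords {k : ℕ} {l : List Bool} (h : l ∈ zeroWords k) :
    displacement l = 0 := (Finset.mem_filter.1 h).2

/-- Follow a path with displacement `y`, then the mirror image of a path with displacement `y`:
the result has displacement zero. -/
theorem add_le_maxValue_zeroWords (w : Edge → ℝ) {n : ℕ} {A : Finset (List Bool)} {y : ℤ}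
    (hA : A.Nonempty) (hlen : ∀ l ∈ A, l.length = n) (hy : ∀ l ∈ A, displacement l = y)
    (u : Vertex) (hu : u.space = y) (hu' : u.level = n) :
    maxValue w origin A hA +
        maxValue (fun e => w (e.reflect.translate u)) origin A hA ≤
      maxValue w origin (zeroWords n) (zeroWords_nonempty n) := by
  obtain ⟨l, hl, e⟩ := exists_wordValue_eq_maxValue w origin hA
  obtain ⟨l', hl', e'⟩ :=
    exists_wordValue_eq_maxValue (fun e => w (e.reflect.translate u)) origin hA
  have hend : endpoint origin l = u :=
    Vertex.eq_of (by rw [space_endpoint, hy l hl, hu]; exact zero_add _)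
      (by rw [level_endpoint, hlen l hl, hu']; exact zero_add _)
  have h2 : wordValue (fun e => w (e.reflect.translate u)) origin l'
      = wordValue w u (l'.map not) := by
    rw [wordValue_reflect (fun e => w (e.translate u)) origin l', reflect_origin,
      wordValue_translate, translate_origin]
  rw [e, e', h2, ← hend, ← wordValue_append]
  refine wordValue_le_maxValue w origin _ (Finset.mem_filter.2 ⟨mem_words.2 ?_, ?_⟩)
  · rw [List.length_append, List.length_map, hlen l hl, hlen l' hl']; omega
  · rw [displacement_append, displacement_map_not, hy l hl, hy l' hl', add_neg_cancel]

/-! ### Independence of disjoint groups of variables -/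

/-- Disjoint groups of independent random variables are independent. -/
theorem iIndepFun_restrict_of_disjoint {Ω ι κ β : Type*} [MeasurableSpace Ω] [MeasurableSpace β]
    {P : Measure Ω} {X : ι → Ω → β} (hX : ∀ i, Measurable (X i)) (h : iIndepFun X P)
    {S : κ → Set ι} (hS : Pairwise (Function.onFun Disjoint S)) :
    iIndepFun (fun k ω (i : S k) => X i ω) P := by
  have := h.isProbabilityMeasure
  have hp : ∀ i, IsProbabilityMeasure (P.map (X i)) :=
    fun i => Measure.isProbabilityMeasure_map (hX i).aemeasurable
  have hinj : Function.Injective (fun p : (k : κ) × S k => (p.2 : ι)) := by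
    rintro ⟨k, i, hi⟩ ⟨k', i', hi'⟩ hii
    obtain rfl : i = i' := hii
    obtain rfl : k = k' := by
      by_contra hne
      exact Set.disjoint_left.1 (hS hne) hi hi'
    rfl
  have h1 : iIndepFun (fun (p : (k : κ) × S k) ω => X p.2 ω) P := h.precomp hinj
  rw [iIndepFun_iff_map_fun_eq_infinitePi_map (by fun_prop)] at h1 ⊢
  have h2 : (MeasurableEquiv.piCurry fun (k : κ) (_ : S k) => β) ∘
      (fun ω (p : (k : κ) × S k) => X p.2 ω) = fun ω k (i : S k) => X i ω := by
    ext; simp [Sigma.curry]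
  rw [← h2, ← Measure.map_map (by fun_prop) (by fun_prop), h1,
    Measure.infinitePi_map_piCurry (fun (k : κ) (i : S k) => P.map (X i))]
  congr 1
  funext k
  exact ((iIndepFun_iff_map_fun_eq_infinitePi_map (by fun_prop)).1
    (h.precomp (g := fun i : S k => (i : ι)) Subtype.val_injective)).symm

/-! ### Exponential concentration for functions of independent variables -/

section Concentration

variable {U : Type*} [NormedAddCommGroup U] [MeasurableSpace U] [BorelSpace U]
  [SecondCountableTopology U]

theorem integrable_exp_of_integrable_exp_abs {V : Type*} [MeasurableSpace V] {β : Measure V}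
    {f : V → ℝ} (hf : Measurable f) (h : Integrable (fun z => Real.exp |f z|) β) :
    Integrable (fun z => Real.exp (f z)) β :=
  h.mono' (by fun_prop) (Eventually.of_forall fun z => by
    rw [Real.norm_eq_abs, Real.abs_exp]
    exact Real.exp_le_exp.2 (le_abs_self _))

theorem integrable_of_integrable_exp_abs {V : Type*} [MeasurableSpace V] {β : Measure V}
    {f : V → ℝ} (hf : Measurable f) (h : Integrable (fun z => Real.exp |f z|) β) :
    Integrable f β :=
  h.mono' (by fun_prop) (Eventually.of_forall fun z => by
    rw [Real.norm_eq_abs]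
    linarith [Real.add_one_le_exp |f z|])

/-- The one-variable case, by Jensen's inequality and symmetrization:
`𝔼 exp (g - 𝔼 g) ≤ 𝔼 exp (g(x) - g(x')) = 𝔼 cosh (g(x) - g(x'))` for independent `x`, `x'`. -/
theorem integral_exp_sub_integral_le_cosh (α : Measure U) [IsProbabilityMeasure α] {g : U → ℝ}
    (hg : Measurable g) (hL : ∀ x x', |g x - g x'| ≤ ‖x - x'‖)
    (hα : Integrable (fun x => Real.exp ‖x‖) α) :
    Integrable (fun x => Real.exp |g x|) α ∧
      ∫ x, Real.exp (g x - ∫ y, g y ∂α) ∂α ≤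
        ∫ p, Real.cosh ‖p.1 - p.2‖ ∂(α.prod α) := by
  have hi : Integrable (fun x => Real.exp |g x|) α := by
    refine (hα.const_mul (Real.exp |g 0|)).mono' (by fun_prop) (Eventually.of_forall fun x => ?_)
    rw [Real.norm_eq_abs, Real.abs_exp, ← Real.exp_add]
    refine Real.exp_le_exp.2 ?_
    have h1 := hL x 0
    rw [sub_zero] at h1
    have h2 := abs_add_le (g 0) (g x - g 0)
    rw [add_sub_cancel] at h2
    linarith
  refine ⟨hi, ?_⟩
  have hgi := integrable_of_integrable_exp_abs hg hi
  have he := integrable_exp_of_integrable_exp_abs hg hi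
  have hen : Integrable (fun x => Real.exp (-g x)) α :=
    integrable_exp_of_integrable_exp_abs (f := fun x => -g x) (by fun_prop) (by simpa using hi)
  have hJ : Real.exp (-∫ y, g y ∂α) ≤ ∫ y, Real.exp (-g y) ∂α := by
    rw [← integral_neg]
    exact convexOn_exp.map_integral_le Real.continuous_exp.continuousOn isClosed_univ
      (by simp) hgi.neg hen
  have hcosh : Integrable (fun p : U × U => Real.cosh ‖p.1 - p.2‖) (α.prod α) := by
    refine (hα.mul_prod hα).mono' (by fun_prop) (Eventually.of_forall fun p => ?_)
    rw [Real.norm_of_nonneg (Real.cosh_pos _).le, ← Real.exp_add]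
    have h1 : Real.cosh ‖p.1 - p.2‖ ≤ Real.exp ‖p.1 - p.2‖ := by
      rw [Real.cosh_eq]
      have : Real.exp (-‖p.1 - p.2‖) ≤ Real.exp ‖p.1 - p.2‖ :=
        Real.exp_le_exp.2 (by linarith [norm_nonneg (p.1 - p.2)])
      linarith
    exact h1.trans (Real.exp_le_exp.2 (norm_sub_le _ _))
  have hm1 := he.mul_prod hen
  have hm2 := hen.mul_prod he
  have hI1 := integral_prod_mul (μ := α) (ν := α) (fun x => Real.exp (g x))
    (fun x => Real.exp (-g x))
  have hI2 := integral_prod_mul (μ := α) (ν := α) (fun x => Real.exp (-g x))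
    (fun x => Real.exp (g x))
  have hsum : ∫ p, Real.cosh (g p.1 - g p.2) ∂(α.prod α) =
      (∫ x, Real.exp (g x) ∂α) * ∫ x, Real.exp (-g x) ∂α := by
    have h3 : ∀ p : U × U, Real.cosh (g p.1 - g p.2) =
        (Real.exp (g p.1) * Real.exp (-g p.2) + Real.exp (-g p.1) * Real.exp (g p.2)) / 2 := by
      intro p
      rw [Real.cosh_eq, ← Real.exp_add, ← Real.exp_add]
      ring_nf
    simp_rw [h3]
    rw [integral_div, integral_add hm1 hm2, hI1, hI2]
    ring
  have hcg : Integrable (fun p : U × U => Real.cosh (g p.1 - g p.2)) (α.prod α) :=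
    hcosh.mono' (by fun_prop) (Eventually.of_forall fun p => by
      rw [Real.norm_of_nonneg (Real.cosh_pos _).le, Real.cosh_le_cosh, abs_norm]
      exact hL _ _)
  calc ∫ x, Real.exp (g x - ∫ y, g y ∂α) ∂α
      = (∫ x, Real.exp (g x) ∂α) * Real.exp (-∫ y, g y ∂α) := by
        rw [← integral_mul_const]
        simp_rw [← Real.exp_add, sub_eq_add_neg]
    _ ≤ (∫ x, Real.exp (g x) ∂α) * ∫ x, Real.exp (-g x) ∂α :=
        mul_le_mul_of_nonneg_left hJ (integral_nonneg fun _ => (Real.exp_pos _).le)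
    _ = ∫ p, Real.cosh (g p.1 - g p.2) ∂(α.prod α) := hsum.symm
    _ ≤ ∫ p, Real.cosh ‖p.1 - p.2‖ ∂(α.prod α) :=
        integral_mono hcg hcosh fun p => by
          rw [Real.cosh_le_cosh, abs_norm]
          exact hL _ _

/-- The induction step of `integral_exp_sub_integral_le_pow`: adjoin one variable. -/
theorem integral_exp_sub_integral_prod_le {V : Type*} [MeasurableSpace V] (α : Measure U)
    [IsProbabilityMeasure α] (β : Measure V) [IsProbabilityMeasure β] {f : U × V → ℝ}
    (hf : Measurable f) {B C : ℝ} (hB0 : 0 ≤ B)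
    (hα : Integrable (fun x => Real.exp ‖x‖) α)
    (hC : ∫ p, Real.cosh ‖p.1 - p.2‖ ∂(α.prod α) ≤ C)
    (hβ : ∀ x, Integrable (fun z => Real.exp |f (x, z)|) β)
    (hB : ∀ x, ∫ z, Real.exp (f (x, z) - ∫ z', f (x, z') ∂β) ∂β ≤ B)
    (hL : ∀ x x' z, |f (x, z) - f (x', z)| ≤ ‖x - x'‖) :
    Integrable (fun p => Real.exp |f p|) (α.prod β) ∧
      ∫ p, Real.exp (f p - ∫ q, f q ∂(α.prod β)) ∂(α.prod β) ≤ C * B := by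
  have hi : Integrable (fun p => Real.exp |f p|) (α.prod β) := by
    refine (hα.mul_prod (hβ 0)).mono' (by fun_prop) (Eventually.of_forall fun p => ?_)
    rw [Real.norm_eq_abs, Real.abs_exp, ← Real.exp_add]
    refine Real.exp_le_exp.2 ?_
    have h1 := hL p.1 0 p.2
    rw [sub_zero] at h1
    have h2 := abs_add_le (f (0, p.2)) (f p - f (0, p.2))
    rw [add_sub_cancel] at h2
    linarith
  refine ⟨hi, ?_⟩
  have hfi := integrable_of_integrable_exp_abs hf hi
  have hfx : ∀ x, Integrable (fun z => f (x, z)) β := fun x =>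
    integrable_of_integrable_exp_abs (by fun_prop) (hβ x)
  set g : U → ℝ := fun x => ∫ z, f (x, z) ∂β with hg_def
  have hg : Measurable g := (hf.stronglyMeasurable.integral_prod_right').measurable
  have hgL : ∀ x x', |g x - g x'| ≤ ‖x - x'‖ := by
    intro x x'
    rw [hg_def]
    simp only []
    rw [← integral_sub (hfx x) (hfx x')]
    refine (abs_integral_le_integral_abs).trans ?_
    refine (integral_mono ((hfx x).sub (hfx x')).abs (integrable_const ‖x - x'‖)
      fun z => hL x x' z).trans ?_
    simp
  obtain ⟨hgi, hgC⟩ := integral_exp_sub_integral_le_cosh α hg hgL hα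
  have hm : ∫ q, f q ∂(α.prod β) = ∫ x, g x ∂α := integral_prod _ hfi
  set m := ∫ x, g x ∂α
  have hexp : Integrable (fun p => Real.exp (f p - m)) (α.prod β) := by
    simp_rw [sub_eq_add_neg, Real.exp_add]
    exact (integrable_exp_of_integrable_exp_abs hf hi).mul_const _
  have hgexp : Integrable (fun x => Real.exp (g x - m)) α := by
    simp_rw [sub_eq_add_neg, Real.exp_add]
    exact (integrable_exp_of_integrable_exp_abs hg hgi).mul_const _
  rw [hm, integral_prod _ hexp]
  calc ∫ x, ∫ z, Real.exp (f (x, z) - m) ∂β ∂α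
      ≤ ∫ x, Real.exp (g x - m) * B ∂α := by
        refine integral_mono hexp.integral_prod_left (hgexp.mul_const _) fun x => ?_
        have : ∀ z, Real.exp (f (x, z) - m) =
            Real.exp (g x - m) * Real.exp (f (x, z) - g x) := by
          intro z
          rw [← Real.exp_add]
          ring_nf
        simp_rw [this]
        rw [integral_const_mul]
        exact mul_le_mul_of_nonneg_left (hB x) (Real.exp_pos _).le
    _ = (∫ x, Real.exp (g x - m) ∂α) * B := integral_mul_const _ _
    _ ≤ C * B := mul_le_mul_of_nonneg_right (hgC.trans hC) hB0

/-- A bounded-difference inequality with unbounded differences. The variables need not be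
bounded: only `𝔼 cosh ‖x - x'‖` enters, for two independent copies `x`, `x'` of a variable. -/
theorem integral_exp_sub_integral_le_pow {C : ℝ} (hC0 : 0 ≤ C) {n : ℕ} (ρ : Fin n → Measure U)
    [∀ i, IsProbabilityMeasure (ρ i)] (hint : ∀ i, Integrable (fun s => Real.exp ‖s‖) (ρ i))
    (hC : ∀ i, ∫ p, Real.cosh ‖p.1 - p.2‖ ∂((ρ i).prod (ρ i)) ≤ C) {f : (Fin n → U) → ℝ}
    (hf : Measurable f) (hL : ∀ x i s, |f x - f (Function.update x i s)| ≤ ‖x i - s‖) :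
    Integrable (fun x => Real.exp |f x|) (Measure.pi ρ) ∧
      ∫ x, Real.exp (f x - ∫ y, f y ∂(Measure.pi ρ)) ∂(Measure.pi ρ) ≤ C ^ n := by
  induction n with
  | zero =>
    rw [Measure.pi_of_empty ρ default]
    refine ⟨integrable_dirac (by simp), ?_⟩
    simp
  | succ n ih =>
    let e := MeasurableEquiv.piFinSuccAbove (fun _ : Fin (n + 1) => U) 0
    have hmp := measurePreserving_piFinSuccAbove ρ 0
    have hmp' : MeasurePreserving e.symm
        ((ρ 0).prod (Measure.pi fun j : Fin n => ρ ((0 : Fin (n + 1)).succAbove j)))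
        (Measure.pi ρ) := hmp.symm e
    have he : ∀ p, e.symm p = Fin.cons p.1 p.2 := fun p => by
      simp [e, MeasurableEquiv.piFinSuccAbove]
      rfl
    have hfe : Measurable (fun p => f (e.symm p)) := by fun_prop
    have hfib : ∀ x, Measurable (fun z : Fin n → U => f (e.symm (x, z))) := fun x => by fun_prop
    have ih' := fun x => ih (fun j : Fin n => ρ ((0 : Fin (n + 1)).succAbove j))
      (fun j => hint _) (fun j => hC _) (hfib x) (fun z i s => by
        have h1 := hL (Fin.cons x z) i.succ s
        rw [← Fin.cons_update, Fin.cons_succ] at h1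
        rw [he, he]
        exact h1)
    obtain ⟨h1, h2⟩ := integral_exp_sub_integral_prod_le (ρ 0)
      (Measure.pi fun j : Fin n => ρ ((0 : Fin (n + 1)).succAbove j)) hfe (pow_nonneg hC0 n)
      (hint 0) (hC 0) (fun x => (ih' x).1) (fun x => (ih' x).2) (fun x x' z => by
        have h1 := hL (Fin.cons x z) 0 x'
        rw [Fin.update_cons_zero, Fin.cons_zero] at h1
        rw [he, he]
        exact h1)
    constructor
    · exact (hmp'.integrable_comp_emb e.symm.measurableEmbedding).1 h1
    · rw [← hmp'.integral_comp e.symm.measurableEmbedding (fun y => f y),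
        ← hmp'.integral_comp e.symm.measurableEmbedding, pow_succ']
      exact h2

end Concentration

/-! ### Elementary bounds on the hyperbolic cosine -/

/-- For small `t` the bound is `cosh t ≤ exp (t² / 2)`, for `t² > η` it is `cosh t ≤ exp t`.
The exponent `12` makes the last term, summed over `n` layers and `O(n²)` edges each, bounded for
`t` of order `n ^ (-1/2)` and `η` of the same order. -/
theorem cosh_le_add_pow_mul_exp {η t : ℝ} (hη : 0 < η) (hη1 : η ≤ 1) (ht : 0 ≤ t) :
    Real.cosh t ≤ 1 + η + t ^ 12 * Real.exp t / η ^ 6 := by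
  by_cases h : t ^ 2 ≤ η
  · have h1 : Real.cosh t ≤ Real.exp (t ^ 2 / 2) := Real.cosh_le_exp_half_sq t
    have h2 : Real.exp (t ^ 2 / 2) ≤ Real.exp (η / 2) := Real.exp_le_exp.2 (by linarith)
    have h3 : Real.exp (η / 2) ≤ 1 / (1 - η / 2) := by
      rw [le_div_iff₀ (by linarith)]
      have := Real.add_one_le_exp (-(η / 2))
      calc Real.exp (η / 2) * (1 - η / 2) ≤ Real.exp (η / 2) * Real.exp (-(η / 2)) :=
            mul_le_mul_of_nonneg_left (by linarith) (Real.exp_pos _).le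
        _ = 1 := by rw [← Real.exp_add]; simp
    have h4 : 1 / (1 - η / 2) ≤ 1 + η := by
      rw [div_le_iff₀ (by linarith)]
      nlinarith
    have h5 : 0 ≤ t ^ 12 * Real.exp t / η ^ 6 := by positivity
    linarith
  · have h1 : Real.cosh t ≤ Real.exp t := by
      rw [Real.cosh_eq]
      have : Real.exp (-t) ≤ Real.exp t := Real.exp_le_exp.2 (by linarith)
      linarith
    have h2 : 1 * Real.exp t ≤ t ^ 12 / η ^ 6 * Real.exp t := by
      refine mul_le_mul_of_nonneg_right ?_ (Real.exp_pos _).le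
      rw [le_div_iff₀ (by positivity), one_mul]
      calc η ^ 6 ≤ (t ^ 2) ^ 6 := pow_le_pow_left₀ hη.le (not_le.1 h).le 6
        _ = t ^ 12 := by ring
    have h3 : t ^ 12 / η ^ 6 * Real.exp t = t ^ 12 * Real.exp t / η ^ 6 := by ring
    linarith

theorem cosh_norm_le_sum {E : Type*} [Fintype E] {η : ℝ} (hη : 0 < η) (hη1 : η ≤ 1)
    (x : E → ℝ) :
    Real.cosh ‖x‖ ≤ 1 + η + (∑ e, |x e| ^ 12 * Real.exp |x e|) / η ^ 6 := by
  refine (cosh_le_add_pow_mul_exp hη hη1 (norm_nonneg x)).trans ?_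
  have hsum : ‖x‖ ^ 12 * Real.exp ‖x‖ ≤ ∑ e, |x e| ^ 12 * Real.exp |x e| := by
    rcases isEmpty_or_nonempty E with hE | hE
    · simp [Subsingleton.elim x 0]
    · obtain ⟨e, -, he⟩ := Finset.exists_mem_eq_sup' Finset.univ_nonempty (fun e => ‖x e‖₊)
      have hx : ‖x‖ = |x e| := by
        rw [Pi.norm_def, ← Finset.sup'_eq_sup Finset.univ_nonempty, he]
        simp
      rw [hx]
      exact Finset.single_le_sum (f := fun e => |x e| ^ 12 * Real.exp |x e|)
        (fun e _ => by positivity) (Finset.mem_univ e)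
  gcongr

/-! ### Independent identically distributed weights with exponential moments -/

/-- The edge weights `X` are independent, identically distributed and `exp (c |X_e|)` is
integrable for the constant `c > 0`. -/
structure IsExpField {Ω : Type*} [MeasurableSpace Ω] (P : Measure Ω) (X : Edge → Ω → ℝ)
    (c : ℝ) : Prop where
  pos : 0 < c
  meas : ∀ e, Measurable (X e)
  indep : iIndepFun X P
  ident : ∀ e e', IdentDistrib (X e) (X e') P P
  integrable : ∀ e, Integrable (fun ω => Real.exp (c * |X e ω|)) P

/-- The configuration of weights at the sample point `ω`. -/
def config {Ω : Type*} (X : Edge → Ω → ℝ) (ω : Ω) : Edge → ℝ := fun e => X e ω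

/-- The mean of the maximal value over the paths that start at the origin and follow a word of
`A`. -/
noncomputable def meanValue {Ω : Type*} [MeasurableSpace Ω] (P : Measure Ω) (X : Edge → Ω → ℝ)
    (A : Finset (List Bool)) (hA : A.Nonempty) : ℝ :=
  ∫ ω, maxValue (config X ω) origin A hA ∂P

/-- The exponential moment `𝔼 exp (c |X_e|)` of a weight; it does not depend on the edge. -/
noncomputable def expMoment {Ω : Type*} [MeasurableSpace Ω] (P : Measure Ω) (X : Edge → Ω → ℝ)
    (c : ℝ) : ℝ :=
  ∫ ω, Real.exp (c * |X (outEdge origin true) ω|) ∂P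

/-- The time constant, as the best normalized mean over paths that return to their starting
position. -/
noncomputable def timeConstant {Ω : Type*} [MeasurableSpace Ω] (P : Measure Ω)
    (X : Edge → Ω → ℝ) : ℝ :=
  ⨆ k : ℕ, meanValue P X (zeroWords (k + 1)) (zeroWords_nonempty (k + 1)) / (2 * (k + 1))

theorem exists_lt_meanValue {Ω : Type*} [MeasurableSpace Ω] (P : Measure Ω)
    (X : Edge → Ω → ℝ) {η : ℝ} (hη : 0 < η) :
    ∃ k : ℕ, 0 < k ∧ (timeConstant P X - η) * (2 * k) <
      meanValue P X (zeroWords k) (zeroWords_nonempty k) := by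
  obtain ⟨k, hk⟩ := exists_lt_of_lt_ciSup (sub_lt_self (timeConstant P X) hη)
  refine ⟨k + 1, k.succ_pos, ?_⟩
  rw [lt_div_iff₀ (by positivity)] at hk
  push_cast
  exact hk

theorem card_edgeSet_singleton (v : Vertex) (l : List Bool) :
    (edgeSet v {l}).card = l.length := by
  classical
  rw [edgeSet, Finset.singleton_biUnion, List.toFinset_card_of_nodup (nodup_wordEdges v l),
    length_wordEdges]

namespace IsExpField

variable {Ω : Type*} [MeasurableSpace Ω] {P : Measure Ω} {X : Edge → Ω → ℝ} {c : ℝ}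

theorem isProbabilityMeasure (h : IsExpField P X c) : IsProbabilityMeasure P :=
  h.indep.isProbabilityMeasure

theorem measurable_config (h : IsExpField P X c) : Measurable (config X) :=
  measurable_pi_iff.2 h.meas

theorem measurable_wordValue (h : IsExpField P X c) (v : Vertex) (l : List Bool) :
    Measurable (fun ω => wordValue (config X ω) v l) :=
  (DirectedLattice.measurable_wordValue v l).comp h.measurable_config

theorem measurable_maxValue (h : IsExpField P X c) (v : Vertex) (A : Finset (List Bool))
    (hA : A.Nonempty) : Measurable (fun ω => maxValue (config X ω) v A hA) :=
  (DirectedLattice.measurable_maxValue v A hA).comp h.measurable_config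

/-- The law of the weights is invariant under injective relabellings of the edges. -/
theorem identDistrib_relabel (h : IsExpField P X c) {τ : Edge → Edge}
    (hτ : Function.Injective τ) :
    IdentDistrib (fun ω e => config X ω (τ e)) (config X) P P where
  aemeasurable_fst := (measurable_pi_iff.2 fun e => h.meas (τ e)).aemeasurable
  aemeasurable_snd := h.measurable_config.aemeasurable
  map_eq := by
    have h1 := (h.indep.precomp hτ).map_fun_eq_infinitePi_map (fun e => h.meas (τ e))
    have h2 := h.indep.map_fun_eq_infinitePi_map h.meas
    have h3 : ∀ e, P.map (X (τ e)) = P.map (X e) := fun e => (h.ident (τ e) e).map_eq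
    simp_rw [h3] at h1
    exact h1.trans h2.symm

theorem identDistrib_maxValue (h : IsExpField P X c) (v : Vertex) (A : Finset (List Bool))
    (hA : A.Nonempty) :
    IdentDistrib (fun ω => maxValue (config X ω) v A hA)
      (fun ω => maxValue (config X ω) origin A hA) P P := by
  simp_rw [maxValue_eq_translate _ v]
  exact (h.identDistrib_relabel (Edge.translate_injective v)).comp
    (DirectedLattice.measurable_maxValue origin A hA)

theorem integral_exp_abs (h : IsExpField P X c) (e : Edge) :
    ∫ ω, Real.exp (c * |X e ω|) ∂P = expMoment P X c :=
  ((h.ident e (outEdge origin true)).comp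
    (u := fun x => Real.exp (c * |x|)) (by fun_prop)).integral_eq

theorem one_le_expMoment (h : IsExpField P X c) : 1 ≤ expMoment P X c := by
  have := h.isProbabilityMeasure
  have h1 : ∫ _ : Ω, (1 : ℝ) ∂P ≤ expMoment P X c :=
    integral_mono (integrable_const _) (h.integrable _) fun ω =>
      Real.one_le_exp (mul_nonneg h.pos.le (abs_nonneg _))
  simpa using h1

theorem iIndepFun_abs (h : IsExpField P X c) : iIndepFun (fun e ω => |X e ω|) P :=
  h.indep.comp (fun _ x => |x|) fun _ => by fun_prop

theorem integrable_exp_sum (h : IsExpField P X c) (S : Finset Edge) :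
    Integrable (fun ω => Real.exp (c * ∑ e ∈ S, |X e ω|)) P := by
  have := h.isProbabilityMeasure
  have hm := h.meas
  have h1 := h.iIndepFun_abs.integrable_exp_mul_sum (t := c) (s := S) (fun e => by fun_prop)
    (fun e _ => h.integrable e)
  simpa using h1

theorem integral_exp_sum (h : IsExpField P X c) (S : Finset Edge) :
    ∫ ω, Real.exp (c * ∑ e ∈ S, |X e ω|) ∂P = expMoment P X c ^ S.card := by
  have hm := h.meas
  have h1 := h.iIndepFun_abs.mgf_sum (t := c) (fun e => by fun_prop) S
  simp only [mgf, Finset.sum_apply, h.integral_exp_abs, Finset.prod_const] at h1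
  exact h1

theorem integrable_exp_of_abs_le (h : IsExpField P X c) {Y : Ω → ℝ} (hY : Measurable Y)
    (S : Finset Edge) (hle : ∀ ω, |Y ω| ≤ ∑ e ∈ S, |X e ω|) {t : ℝ} (ht : |t| ≤ c) :
    Integrable (fun ω => Real.exp (t * Y ω)) P :=
  (h.integrable_exp_sum S).mono' (by fun_prop) (Eventually.of_forall fun ω => by
    rw [Real.norm_of_nonneg (Real.exp_pos _).le]
    refine Real.exp_le_exp.2 ((le_abs_self _).trans ?_)
    rw [abs_mul]
    exact mul_le_mul ht (hle ω) (abs_nonneg _) h.pos.le)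

theorem integrable_exp_maxValue (h : IsExpField P X c) (v : Vertex) (A : Finset (List Bool))
    (hA : A.Nonempty) {t : ℝ} (ht : |t| ≤ c) :
    Integrable (fun ω => Real.exp (t * maxValue (config X ω) v A hA)) P :=
  h.integrable_exp_of_abs_le (h.measurable_maxValue v A hA) (edgeSet v A)
    (fun ω => abs_maxValue_le (config X ω) v A hA) ht

theorem integrable_maxValue (h : IsExpField P X c) (v : Vertex) (A : Finset (List Bool))
    (hA : A.Nonempty) : Integrable (fun ω => maxValue (config X ω) v A hA) P := by
  have hS : ∀ e, Integrable (X e) P := by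
    intro e
    refine ((h.integrable e).const_mul c⁻¹).mono' (h.meas e).aestronglyMeasurable
      (Eventually.of_forall fun ω => ?_)
    rw [Real.norm_eq_abs, inv_mul_eq_div, le_div_iff₀ h.pos]
    linarith [Real.add_one_le_exp (c * |X e ω|)]
  exact (integrable_finsetSum (edgeSet v A) fun e _ => (hS e).abs).mono'
    (h.measurable_maxValue v A hA).aestronglyMeasurable
    (Eventually.of_forall fun ω => abs_maxValue_le (config X ω) v A hA)

/-- There are at most `2 ^ n` words of length `n`, and each path has exponential moments, so the
mean of the maximum grows at most linearly. -/
theorem meanValue_le (h : IsExpField P X c) {n : ℕ} {A : Finset (List Bool)} (hA : A.Nonempty)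
    (hn : A ⊆ words n) :
    meanValue P X A hA ≤ n * (Real.log (2 * expMoment P X c) / c) := by
  classical
  have := h.isProbabilityMeasure
  have hm := h.one_le_expMoment
  have hJ : Real.exp (c * meanValue P X A hA) ≤
      ∫ ω, Real.exp (c * maxValue (config X ω) origin A hA) ∂P := by
    rw [meanValue, ← integral_const_mul]
    exact convexOn_exp.map_integral_le Real.continuous_exp.continuousOn isClosed_univ
      (by simp) ((h.integrable_maxValue origin A hA).const_mul c)
      (h.integrable_exp_maxValue origin A hA (abs_of_pos h.pos).le)
  have hle : ∫ ω, Real.exp (c * maxValue (config X ω) origin A hA) ∂P ≤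
      ∫ ω, ∑ l ∈ A, Real.exp (c * ∑ e ∈ edgeSet origin {l}, |X e ω|) ∂P := by
    refine integral_mono (h.integrable_exp_maxValue origin A hA (abs_of_pos h.pos).le)
      (integrable_finsetSum _ fun l _ => h.integrable_exp_sum _) fun ω => ?_
    obtain ⟨l, hl, e⟩ := exists_wordValue_eq_maxValue (config X ω) origin hA
    simp only [e]
    refine le_trans (Real.exp_le_exp.2 ?_) (Finset.single_le_sum
      (f := fun l => Real.exp (c * ∑ e ∈ edgeSet origin {l}, |X e ω|))
      (fun _ _ => (Real.exp_pos _).le) hl)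
    exact mul_le_mul_of_nonneg_left ((le_abs_self _).trans
      (abs_wordValue_le (config X ω) (Finset.mem_singleton_self l))) h.pos.le
  rw [integral_finsetSum _ fun l _ => h.integrable_exp_sum _] at hle
  have hsum : ∑ l ∈ A, ∫ ω, Real.exp (c * ∑ e ∈ edgeSet origin {l}, |X e ω|) ∂P ≤
      (2 * expMoment P X c) ^ n := by
    have h1 : ∀ l ∈ A, ∫ ω, Real.exp (c * ∑ e ∈ edgeSet origin {l}, |X e ω|) ∂P
        = expMoment P X c ^ n := by
      intro l hl
      rw [h.integral_exp_sum, card_edgeSet_singleton, mem_words.1 (hn hl)]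
    rw [Finset.sum_congr rfl h1, Finset.sum_const, nsmul_eq_mul, mul_pow]
    refine mul_le_mul_of_nonneg_right ?_ (by positivity)
    have := Finset.card_le_card hn
    rw [card_words] at this
    exact_mod_cast this
  have hlog := Real.log_le_log (Real.exp_pos _) (hJ.trans (hle.trans hsum))
  rw [Real.log_exp, Real.log_pow] at hlog
  rw [← mul_div_assoc, le_div_iff₀ h.pos]
  linarith

theorem bddAbove_meanValue (h : IsExpField P X c) :
    BddAbove (Set.range fun k : ℕ =>
      meanValue P X (zeroWords (k + 1)) (zeroWords_nonempty (k + 1)) / (2 * ((k : ℝ) + 1))) := by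
  refine ⟨Real.log (2 * expMoment P X c) / c, Set.forall_mem_range.2 fun k => ?_⟩
  rw [div_le_iff₀ (by positivity)]
  refine (h.meanValue_le (zeroWords_nonempty (k + 1)) (Finset.filter_subset _ _)).trans
    (le_of_eq ?_)
  push_cast
  ring

theorem meanValue_zeroWords_le (h : IsExpField P X c) {n : ℕ} (hn : 0 < n) :
    meanValue P X (zeroWords n) (zeroWords_nonempty n) ≤ 2 * n * timeConstant P X := by
  obtain ⟨k, rfl⟩ := Nat.exists_eq_succ_of_ne_zero hn.ne'
  have h1 := le_ciSup h.bddAbove_meanValue k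
  rw [div_le_iff₀ (by positivity)] at h1
  push_cast
  rw [mul_comm]
  exact h1

/-- Among the paths with `n` steps and a prescribed end point, the mean of the maximal value is at
most `n` times the time constant. -/
theorem meanValue_le_timeConstant (h : IsExpField P X c) {n : ℕ} (hn : 0 < n)
    {A : Finset (List Bool)} (hA : A.Nonempty) {y : ℤ} (hlen : ∀ l ∈ A, l.length = n)
    (hy : ∀ l ∈ A, displacement l = y) :
    meanValue P X A hA ≤ n * timeConstant P X := by
  obtain ⟨l, hl⟩ := hA
  set u := endpoint origin l
  have hu : u.space = y := by rw [space_endpoint, hy l hl]; exact zero_add _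
  have hu' : u.level = n := by rw [level_endpoint, hlen l hl]; exact zero_add _
  have hid := (h.identDistrib_relabel
    ((Edge.translate_injective u).comp Edge.reflect_injective)).comp
    (DirectedLattice.measurable_maxValue origin A ⟨l, hl⟩)
  have hint : Integrable (fun ω => maxValue
      (fun e => config X ω (e.reflect.translate u)) origin A ⟨l, hl⟩) P :=
    hid.integrable_iff.2 (h.integrable_maxValue origin A ⟨l, hl⟩)
  have heq : ∫ ω, maxValue (fun e => config X ω (e.reflect.translate u)) origin A ⟨l, hl⟩ ∂P =
      meanValue P X A ⟨l, hl⟩ := hid.integral_eq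
  have hle : ∫ ω, (maxValue (config X ω) origin A ⟨l, hl⟩ + maxValue
      (fun e => config X ω (e.reflect.translate u)) origin A ⟨l, hl⟩) ∂P ≤
      meanValue P X (zeroWords n) (zeroWords_nonempty n) :=
    integral_mono ((h.integrable_maxValue origin A ⟨l, hl⟩).add hint)
      (h.integrable_maxValue _ _ _) fun ω =>
        add_le_maxValue_zeroWords (config X ω) ⟨l, hl⟩ hlen hy u hu hu'
  rw [integral_add (h.integrable_maxValue origin A ⟨l, hl⟩) hint, heq] at hle
  have := h.meanValue_zeroWords_le hn
  have h3 : ∫ ω, maxValue (config X ω) origin A ⟨l, hl⟩ ∂P = meanValue P X A ⟨l, hl⟩ := rfl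
  linarith

end IsExpField

/-! ### The upper tail -/

theorem wordValue_smul (a : ℝ) (w : Edge → ℝ) (v : Vertex) (l : List Bool) :
    wordValue (a • w) v l = a * wordValue w v l := by
  classical
  simp [wordValue_eq_sum, Finset.mul_sum]

theorem maxValue_smul {a : ℝ} (ha : 0 ≤ a) (w : Edge → ℝ) (v : Vertex) (A : Finset (List Bool))
    (hA : A.Nonempty) : maxValue (a • w) v A hA = a * maxValue w v A hA := by
  apply le_antisymm
  · obtain ⟨l, hl, e⟩ := exists_wordValue_eq_maxValue (a • w) v hA
    rw [e, wordValue_smul]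
    exact mul_le_mul_of_nonneg_left (wordValue_le_maxValue w v hA hl) ha
  · obtain ⟨l, hl, e⟩ := exists_wordValue_eq_maxValue w v hA
    rw [e, ← wordValue_smul]
    exact wordValue_le_maxValue (a • w) v hA hl

theorem pow_mul_exp_le {c t v : ℝ} (hc : 0 < c) (ht : 0 < t) (htc : t ≤ c / 2) (hv : 0 ≤ v) :
    v ^ 12 * Real.exp v ≤
      t ^ 12 * ((Nat.factorial 12 : ℝ) * (2 / c) ^ 12) * Real.exp (c / t * v) := by
  have h1 : Real.exp v ≤ Real.exp (c / t * v / 2) := by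
    refine Real.exp_le_exp.2 ?_
    have : 1 ≤ c / t / 2 := by
      rw [div_div, le_div_iff₀ (by positivity)]
      linarith
    nlinarith
  have h2 := Real.pow_div_factorial_le_exp (c / t * v / 2) (by positivity) 12
  rw [div_le_iff₀ (by positivity)] at h2
  have h3 : v ^ 12 = t ^ 12 * (2 / c) ^ 12 * (c / t * v / 2) ^ 12 := by
    field_simp
  have h4 : Real.exp (c / t * v) = Real.exp (c / t * v / 2) * Real.exp (c / t * v / 2) := by
    rw [← Real.exp_add]; ring_nf
  rw [h3, h4]
  calc t ^ 12 * (2 / c) ^ 12 * (c / t * v / 2) ^ 12 * Real.exp v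
      ≤ t ^ 12 * (2 / c) ^ 12 * (Real.exp (c / t * v / 2) * (Nat.factorial 12 : ℝ)) *
        Real.exp (c / t * v / 2) := by gcongr
    _ = _ := by ring

/-- The weights of level `i` on the edges in `E`, scaled by `t` and extended by zero to the other
levels. -/
noncomputable def layer (E : Finset Edge) (t : ℝ) (i : ℕ) (w : Edge → ℝ) : E → ℝ :=
  fun e => if (e : Edge).src.level = i then t * w e else 0

/-- The weights obtained by assembling `n` layers. -/
noncomputable def assemble (E : Finset Edge) (n : ℕ) (s : Fin n → E → ℝ) : Edge → ℝ :=
  open Classical in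
  fun e => if he : e ∈ E then if hn : e.src.level < n then s ⟨e.src.level, hn⟩ ⟨e, he⟩ else 0
    else 0

theorem measurable_assemble (E : Finset Edge) (n : ℕ) : Measurable (assemble E n) := by
  refine measurable_pi_iff.2 fun e => ?_
  unfold assemble
  split_ifs <;> fun_prop

theorem assemble_layer {E : Finset Edge} {n : ℕ} (t : ℝ) (w : Edge → ℝ) {e : Edge} (he : e ∈ E)
    (hn : e.src.level < n) : assemble E n (fun i => layer E t i w) e = t * w e := by
  simp [assemble, layer, he, hn]

theorem abs_maxValue_assemble_sub_le {n : ℕ} {A : Finset (List Bool)} (hA : A.Nonempty)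
    (E : Finset Edge) (s : Fin n → E → ℝ) (i : Fin n) (r : E → ℝ) :
    |maxValue (assemble E n s) origin A hA -
      maxValue (assemble E n (Function.update s i r)) origin A hA| ≤ ‖s i - r‖ := by
  refine abs_maxValue_sub_le fun l _ => abs_wordValue_sub_le (i : ℕ) (norm_nonneg _) ?_ ?_
  · intro e _ hei
    unfold assemble
    split_ifs with h1 h2
    · rw [Function.update_of_ne]
      intro h
      exact hei (congrArg Fin.val h)
    · rfl
    · rfl
  · intro e _
    unfold assemble
    split_ifs with h1 h2
    · by_cases h : (⟨e.src.level, h2⟩ : Fin n) = i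
      · rw [h, Function.update_self]
        exact norm_le_pi_norm (s i - r) ⟨e, h1⟩
      · rw [Function.update_of_ne h]
        simp
    · simp
    · simp

namespace IsExpField

variable {Ω : Type*} [MeasurableSpace Ω] {P : Measure Ω} {X : Edge → Ω → ℝ} {c : ℝ}

theorem measurable_layer (h : IsExpField P X c) (E : Finset Edge) (t : ℝ) (i : ℕ) :
    Measurable (fun ω => layer E t i (config X ω)) := by
  refine measurable_pi_iff.2 fun e => ?_
  unfold layer
  split_ifs
  · exact (h.meas e).const_mul t
  · fun_prop

theorem iIndepFun_layer (h : IsExpField P X c) (E : Finset Edge) (t : ℝ) (n : ℕ) :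
    iIndepFun (fun (i : Fin n) ω => layer E t i (config X ω)) P := by
  let S : Fin n → Set Edge := fun i => {e | e.src.level = i}
  have hS : Pairwise (Function.onFun Disjoint S) := by
    intro i j hij
    refine Set.disjoint_left.2 fun e hi hj => hij (Fin.ext ?_)
    exact (show e.src.level = i from hi).symm.trans hj
  have h1 := iIndepFun_restrict_of_disjoint h.meas h.indep hS
  have h2 := h1.comp (fun i (r : S i → ℝ) (e : E) =>
    if he : (e : Edge).src.level = i then t * r ⟨e, he⟩ else 0) (fun i => by
      refine measurable_pi_iff.2 fun e => ?_
      split_ifs <;> fun_prop)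
  convert h2 using 2 with i
  ext ω e
  simp [layer, config]

theorem integrable_exp_norm_layer (h : IsExpField P X c) (E : Finset Edge) {t : ℝ} (ht : 0 ≤ t)
    (htc : t ≤ c) (i : ℕ) :
    Integrable (fun ω => Real.exp ‖layer E t i (config X ω)‖) P := by
  refine (h.integrable_exp_sum E).mono' ?_ (Eventually.of_forall fun ω => ?_)
  · exact (Real.measurable_exp.comp (h.measurable_layer E t i).norm).aestronglyMeasurable
  · rw [Real.norm_of_nonneg (Real.exp_pos _).le]
    refine Real.exp_le_exp.2 ?_
    rw [pi_norm_le_iff_of_nonneg (mul_nonneg h.pos.le (Finset.sum_nonneg fun _ _ => abs_nonneg _))]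
    intro e
    have h1 : |X e ω| ≤ ∑ e ∈ E, |X e ω| :=
      Finset.single_le_sum (f := fun e => |X e ω|) (fun _ _ => abs_nonneg _) e.2
    have h2 : ‖layer E t i (config X ω) e‖ ≤ t * |X e ω| := by
      unfold layer
      split_ifs
      · rw [Real.norm_eq_abs, abs_mul, abs_of_nonneg ht]
        rfl
      · simp; positivity
    exact h2.trans (mul_le_mul htc h1 (abs_nonneg _) h.pos.le)

theorem exp_abs_layer_le (h : IsExpField P X c) (E : Finset Edge) {t : ℝ} (ht : 0 < t)
    (i : ℕ) (e : E) (ω : Ω) :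
    Real.exp (c / t * |layer E t i (config X ω) e|) ≤ Real.exp (c * |X e ω|) := by
  refine Real.exp_le_exp.2 ?_
  unfold layer
  split_ifs
  · rw [abs_mul, abs_of_pos ht, ← mul_assoc, div_mul_cancel₀ _ ht.ne']
    rfl
  · simpa using mul_nonneg h.pos.le (abs_nonneg _)

/-- For two independent copies of a layer, `𝔼 cosh` of the distance is close to one. -/
theorem integral_cosh_layer_le (h : IsExpField P X c) (E : Finset Edge) {t η : ℝ} (ht : 0 < t)
    (htc : t ≤ c / 2) (hη : 0 < η) (hη1 : η ≤ 1) (i : ℕ) (ρ : Measure (E → ℝ))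
    (hρ : ρ = P.map (fun ω => layer E t i (config X ω))) :
    ∫ p, Real.cosh ‖p.1 - p.2‖ ∂(ρ.prod ρ) ≤ 1 + η + E.card * (t ^ 12 *
      ((Nat.factorial 12 : ℝ) * (2 / c) ^ 12) * expMoment P X c ^ 2) / η ^ 6 := by
  have := h.isProbabilityMeasure
  have hc := h.pos
  have hml := h.measurable_layer E t i
  have hprob : IsProbabilityMeasure ρ := hρ ▸ Measure.isProbabilityMeasure_map hml.aemeasurable
  set K : ℝ := t ^ 12 * ((Nat.factorial 12 : ℝ) * (2 / c) ^ 12) with hK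
  have hK0 : 0 ≤ K := by positivity
  let F : E → (E → ℝ) → ℝ := fun e s => Real.exp (c / t * |s e|)
  have hFm : ∀ e, Measurable (F e) := fun e => by fun_prop
  have hFΩ : ∀ e, Integrable (fun ω => F e (layer E t i (config X ω))) P := fun e =>
    (h.integrable e).mono' ((hFm e).comp hml).aestronglyMeasurable
      (Eventually.of_forall fun ω => by
        rw [Real.norm_of_nonneg (Real.exp_pos _).le]
        exact h.exp_abs_layer_le E ht i e ω)
  have hFi : ∀ e, Integrable (F e) ρ := fun e => by
    rw [hρ, integrable_map_measure (hFm e).aestronglyMeasurable hml.aemeasurable]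
    exact hFΩ e
  have hFle : ∀ e, ∫ s, F e s ∂ρ ≤ expMoment P X c := fun e => by
    rw [hρ, integral_map hml.aemeasurable (hFm e).aestronglyMeasurable, ← h.integral_exp_abs e]
    exact integral_mono (hFΩ e) (h.integrable e) fun ω => h.exp_abs_layer_le E ht i e ω
  have hprod : ∀ e, Integrable (fun p : (E → ℝ) × (E → ℝ) => K * (F e p.1 * F e p.2))
      (ρ.prod ρ) := fun e => ((hFi e).mul_prod (hFi e)).const_mul K
  have hsumi := integrable_finsetSum (μ := ρ.prod ρ) Finset.univ fun e _ => hprod e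
  have hbound : ∀ p : (E → ℝ) × (E → ℝ), Real.cosh ‖p.1 - p.2‖ ≤
      1 + η + (∑ e, K * (F e p.1 * F e p.2)) / η ^ 6 := by
    intro p
    refine (cosh_norm_le_sum hη hη1 _).trans ?_
    suffices hs : ∀ e, |(p.1 - p.2) e| ^ 12 * Real.exp |(p.1 - p.2) e| ≤
        K * (F e p.1 * F e p.2) by
      have hs' := Finset.sum_le_sum fun e (_ : e ∈ Finset.univ) => hs e
      gcongr
    intro e
    have hle : |(p.1 - p.2) e| ≤ |p.1 e| + |p.2 e| := abs_sub _ _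
    calc |(p.1 - p.2) e| ^ 12 * Real.exp |(p.1 - p.2) e|
        ≤ (|p.1 e| + |p.2 e|) ^ 12 * Real.exp (|p.1 e| + |p.2 e|) := by gcongr
      _ ≤ K * Real.exp (c / t * (|p.1 e| + |p.2 e|)) :=
          pow_mul_exp_le hc ht htc (by positivity)
      _ = K * (F e p.1 * F e p.2) := by
          simp only [F]
          rw [mul_add, Real.exp_add]
  have hrhs : Integrable (fun p : (E → ℝ) × (E → ℝ) =>
      1 + η + (∑ e, K * (F e p.1 * F e p.2)) / η ^ 6) (ρ.prod ρ) :=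
    (integrable_const _).add (hsumi.div_const _)
  refine (integral_mono_of_nonneg (Eventually.of_forall fun p => (Real.cosh_pos _).le) hrhs
    (Eventually.of_forall hbound)).trans ?_
  rw [integral_add (integrable_const _) (hsumi.div_const _), integral_div,
    integral_finsetSum _ fun e _ => hprod e]
  have hterm : ∀ e : E, ∫ p, K * (F e p.1 * F e p.2) ∂(ρ.prod ρ) ≤
      K * expMoment P X c ^ 2 := by
    intro e
    rw [integral_const_mul, integral_prod_mul (F e) (F e), sq]
    have h0 : 0 ≤ ∫ s, F e s ∂ρ := integral_nonneg fun _ => (Real.exp_pos _).le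
    exact mul_le_mul_of_nonneg_left
      (mul_le_mul (hFle e) (hFle e) h0 (h0.trans (hFle e))) hK0
  have hsum := Finset.sum_le_sum fun (e : E) (_ : e ∈ Finset.univ) => hterm e
  rw [Finset.sum_const, Finset.card_univ, Fintype.card_coe, nsmul_eq_mul] at hsum
  simp only [integral_const, probReal_univ, smul_eq_mul, one_mul]
  gcongr

/-- Concentration of the maximal value around its mean, in exponential form. -/
theorem integral_exp_maxValue_sub_le (h : IsExpField P X c) {n : ℕ} {A : Finset (List Bool)}
    (hA : A.Nonempty) (hn : A ⊆ words n) {t η : ℝ} (ht : 0 < t)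
    (htc : t ≤ c / 2) (hη : 0 < η) (hη1 : η ≤ 1) :
    ∫ ω, Real.exp (t * (maxValue (config X ω) origin A hA - meanValue P X A hA)) ∂P ≤
      (1 + η + (edgeSet origin A).card * (t ^ 12 *
        ((Nat.factorial 12 : ℝ) * (2 / c) ^ 12) * expMoment P X c ^ 2) / η ^ 6) ^ n := by
  have := h.isProbabilityMeasure
  have hc := h.pos
  set E := edgeSet origin A with hE
  set C := 1 + η + E.card * (t ^ 12 *
    ((Nat.factorial 12 : ℝ) * (2 / c) ^ 12) * expMoment P X c ^ 2) / η ^ 6 with hC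
  have hC0 : 0 ≤ C := by positivity
  let Y : Ω → Fin n → E → ℝ := fun ω i => layer E t i (config X ω)
  have hml := fun i : Fin n => h.measurable_layer E t i
  have hY : Measurable Y := measurable_pi_iff.2 hml
  let ρ : Fin n → Measure (E → ℝ) := fun i => P.map (fun ω => layer E t i (config X ω))
  have hρ : ∀ i, IsProbabilityMeasure (ρ i) := fun i =>
    Measure.isProbabilityMeasure_map (hml i).aemeasurable
  have hlaw : P.map Y = Measure.pi ρ :=
    (h.iIndepFun_layer E t n).map_fun_eq_pi_map fun i => (hml i).aemeasurable
  let f : (Fin n → E → ℝ) → ℝ := fun s => maxValue (assemble E n s) origin A hA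
  have hf : Measurable f :=
    (DirectedLattice.measurable_maxValue origin A hA).comp (measurable_assemble E n)
  have hfY : ∀ ω, f (Y ω) = t * maxValue (config X ω) origin A hA := by
    intro ω
    rw [← maxValue_smul ht.le]
    refine maxValue_congr fun e he => ?_
    obtain ⟨l, hl, hel⟩ := mem_edgeSet.1 he
    have h1 := (mem_wordEdges_bounds hel).2.1
    rw [mem_words.1 (hn hl), show origin.level = 0 from rfl, zero_add] at h1
    exact assemble_layer t (config X ω) he h1
  have hmain := (integral_exp_sub_integral_le_pow hC0 ρ (fun i => by
      rw [integrable_map_measure (by fun_prop) (hml i).aemeasurable]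
      exact h.integrable_exp_norm_layer E ht.le (by linarith) i)
    (fun i => h.integral_cosh_layer_le E ht htc hη hη1 i (ρ i) rfl) hf
    (fun s i r => abs_maxValue_assemble_sub_le hA E s i r)).2
  rw [← hlaw, integral_map hY.aemeasurable hf.aestronglyMeasurable,
    integral_map hY.aemeasurable (by fun_prop)] at hmain
  simp only [hfY] at hmain
  rw [integral_const_mul] at hmain
  simpa only [mul_sub, meanValue] using hmain

end IsExpField

/-- The Borel–Cantelli lemma, with a bound on the probabilities that holds eventually. -/
theorem ae_eventually_notMem_of_le {Ω : Type*} [MeasurableSpace Ω] {P : Measure Ω}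
    [IsFiniteMeasure P] {s : ℕ → Set Ω} {b : ℕ → ℝ} (hb : Summable b) {n₀ : ℕ}
    (hs : ∀ n, n₀ ≤ n → P.real (s n) ≤ b n) : ∀ᵐ ω ∂P, ∀ᶠ n in atTop, ω ∉ s n := by
  have hb' : Summable fun n => b (n + n₀) := (summable_nat_add_iff n₀).2 hb
  have hsum : Summable fun n => P.real (s (n + n₀)) :=
    hb'.of_nonneg_of_le (fun _ => measureReal_nonneg) fun n => hs _ (Nat.le_add_left _ _)
  have hne : ∑' n, P (s (n + n₀)) ≠ ⊤ := by
    have h1 : ∀ n, P (s (n + n₀)) = ENNReal.ofReal (P.real (s (n + n₀))) := fun n =>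
      (ofReal_measureReal).symm
    simp_rw [h1]
    exact hsum.tsum_ofReal_ne_top
  filter_upwards [ae_eventually_notMem hne] with ω hω
  obtain ⟨m, hm⟩ := eventually_atTop.1 hω
  refine eventually_atTop.2 ⟨m + n₀, fun n hn => ?_⟩
  have h1 := hm (n - n₀) (by omega)
  rwa [Nat.sub_add_cancel (by omega)] at h1

namespace IsExpField

variable {Ω : Type*} [MeasurableSpace Ω] {P : Measure Ω} {X : Edge → Ω → ℝ} {c : ℝ}

/-- The upper tail decays at least like `exp (-(3/4) ε √n)`, uniformly in the set of words. -/
theorem exists_measure_upper_tail_le (h : IsExpField P X c) {ε : ℝ} (hε : 0 < ε) (hε1 : ε ≤ 1) :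
    ∃ K : ℝ, ∃ n₀ : ℕ, ∀ n, n₀ ≤ n → ∀ (A : Finset (List Bool)) (hA : A.Nonempty), A ⊆ words n →
      P.real {ω | meanValue P X A hA + ε * n ≤ maxValue (config X ω) origin A hA} ≤
        Real.exp (K - 3 / 4 * ε * √n) := by
  have := h.isProbabilityMeasure
  have hc := h.pos
  set K₁ : ℝ := ((Nat.factorial 12 : ℝ) * (2 / c) ^ 12) * expMoment P X c ^ 2 with hK₁
  have hK₁0 : 0 ≤ K₁ := by positivity
  refine ⟨6 * K₁ * (4 / ε) ^ 6, ⌈(2 / c) ^ 2⌉₊ + 1, fun n hn A hA hAn => ?_⟩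
  have hn1 : (1 : ℝ) ≤ n := by
    have : 1 ≤ n := by omega
    exact_mod_cast this
  have hnc : (2 / c) ^ 2 ≤ (n : ℝ) := by
    refine (Nat.le_ceil _).trans ?_
    have : ⌈(2 / c) ^ 2⌉₊ ≤ n := by omega
    exact_mod_cast this
  -- The exponential Chebyshev bound is applied at the parameter `t = 1 / √n`.
  set q := √(n : ℝ) with hq
  have hqn : q ^ 2 = n := Real.sq_sqrt (by positivity)
  have hq1 : 1 ≤ q := Real.one_le_sqrt.2 hn1
  have hq0 : 0 < q := by linarith
  have hqc : 2 / c ≤ q := Real.le_sqrt_of_sq_le hnc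
  have ht : 0 < q⁻¹ := inv_pos.2 hq0
  have ht1 : q⁻¹ ≤ 1 := inv_le_one_of_one_le₀ hq1
  have htc : q⁻¹ ≤ c / 2 := by
    rw [inv_le_comm₀ hq0 (by positivity), inv_div]
    exact hqc
  have hη : 0 < q⁻¹ * ε / 4 := by positivity
  have hη1 : q⁻¹ * ε / 4 ≤ 1 := by nlinarith
  have hmgf := h.integral_exp_maxValue_sub_le hA hAn ht htc hη hη1
  have hcard : ((edgeSet origin A).card : ℝ) ≤ 6 * q ^ 4 := by
    have h1 : ((edgeSet origin A).card : ℝ) ≤ n * (2 * n + 1) * 2 := by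
      exact_mod_cast card_edgeSet_origin_le hAn
    rw [show q ^ 4 = (q ^ 2) ^ 2 by ring, hqn]
    nlinarith
  have hC : (1 + q⁻¹ * ε / 4 + (edgeSet origin A).card * (q⁻¹ ^ 12 *
        ((Nat.factorial 12 : ℝ) * (2 / c) ^ 12) * expMoment P X c ^ 2) / (q⁻¹ * ε / 4) ^ 6) ^ n ≤
      Real.exp (6 * K₁ * (4 / ε) ^ 6 + ε * q / 4) := by
    have h1 : (edgeSet origin A).card * (q⁻¹ ^ 12 *
        ((Nat.factorial 12 : ℝ) * (2 / c) ^ 12) * expMoment P X c ^ 2) / (q⁻¹ * ε / 4) ^ 6 ≤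
        6 * q ^ 4 * (q⁻¹ ^ 12 * K₁) / (q⁻¹ * ε / 4) ^ 6 := by
      rw [hK₁, mul_assoc (q⁻¹ ^ 12)]
      gcongr
    have h2 : (n : ℝ) * (q⁻¹ * ε / 4 + 6 * q ^ 4 * (q⁻¹ ^ 12 * K₁) / (q⁻¹ * ε / 4) ^ 6) =
        6 * K₁ * (4 / ε) ^ 6 + ε * q / 4 := by
      rw [← hqn]
      field_simp
      ring
    rw [← h2, Real.exp_nat_mul]
    refine pow_le_pow_left₀ (by positivity) ?_ n
    have h3 := Real.add_one_le_exp
      (q⁻¹ * ε / 4 + 6 * q ^ 4 * (q⁻¹ ^ 12 * K₁) / (q⁻¹ * ε / 4) ^ 6)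
    linarith
  have hint : Integrable (fun ω => Real.exp (q⁻¹ *
      (maxValue (config X ω) origin A hA - meanValue P X A hA))) P := by
    simp_rw [mul_sub, sub_eq_add_neg, Real.exp_add]
    refine (h.integrable_exp_maxValue origin A hA ?_).mul_const _
    rw [abs_of_pos ht]
    linarith
  have hch := measure_ge_le_exp_mul_mgf (μ := P)
    (X := fun ω => maxValue (config X ω) origin A hA - meanValue P X A hA) (ε * n) ht.le hint
  have hset : {ω | meanValue P X A hA + ε * n ≤ maxValue (config X ω) origin A hA} =
      {ω | ε * n ≤ maxValue (config X ω) origin A hA - meanValue P X A hA} := by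
    ext ω
    simp only [Set.mem_ofPred_eq, le_sub_iff_add_le, add_comm]
  rw [hset]
  refine hch.trans ?_
  refine (mul_le_mul_of_nonneg_left (hmgf.trans hC) (Real.exp_pos _).le).trans (le_of_eq ?_)
  rw [← Real.exp_add]
  congr 1
  rw [← hqn]
  field_simp
  ring

/-- The passage time grows at most at the rate given by the time constant. -/
theorem ae_eventually_lastPassage_lt (h : IsExpField P X c) {ε : ℝ} (hε : 0 < ε) (hε1 : ε ≤ 1) :
    ∀ᵐ ω ∂P, ∀ᶠ n : ℕ in atTop,
      lastPassage (config X ω) n < (timeConstant P X + ε) * n := by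
  have := h.isProbabilityMeasure
  obtain ⟨K, n₀, htail⟩ := h.exists_measure_upper_tail_le hε hε1
  let s : ℕ → Set Ω := fun n =>
    {ω | (timeConstant P X + ε) * n ≤ lastPassage (config X ω) n}
  suffices hs : ∀ᵐ ω ∂P, ∀ᶠ n in atTop, ω ∉ s n by
    filter_upwards [hs] with ω hω
    filter_upwards [hω] with n hn
    exact not_le.1 hn
  let b : ℕ → ℝ := fun n => (3 * Real.exp K * 720 / (3 / 4 * ε) ^ 6) * ((n : ℝ) ^ 2)⁻¹
  have hb : Summable b := (Real.summable_nat_pow_inv.2 one_lt_two).mul_left _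
  refine ae_eventually_notMem_of_le hb (n₀ := n₀ + 1) fun n hn => ?_
  have hn1 : (1 : ℝ) ≤ n := by
    have : 1 ≤ n := by omega
    exact_mod_cast this
  let F : ℤ → Set Ω := fun y => {ω | ∃ l ∈ words n, displacement l = y ∧
    (timeConstant P X + ε) * n ≤ wordValue (config X ω) origin l}
  have hsub : s n ⊆ ⋃ y ∈ Finset.Icc (-(n : ℤ)) n, F y := by
    intro ω hω
    obtain ⟨l, hl, e⟩ :=
      exists_wordValue_eq_maxValue (config X ω) origin (words_nonempty n)
    have h1 : (timeConstant P X + ε) * n ≤ lastPassage (config X ω) n := hω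
    rw [lastPassage_eq_maxValue, e] at h1
    have h2 := abs_displacement_le l
    rw [mem_words.1 hl, abs_le] at h2
    exact Set.mem_biUnion (Finset.mem_coe.2 (Finset.mem_Icc.2 h2)) ⟨l, hl, rfl, h1⟩
  have hF : ∀ y, P.real (F y) ≤ Real.exp (K - 3 / 4 * ε * √n) := by
    intro y
    by_cases hA : ((words n).filter fun l => displacement l = y).Nonempty
    · refine le_trans (measureReal_mono ?_) (htail n (by omega) _ hA (Finset.filter_subset _ _))
      rintro ω ⟨l, hl, hly, hv⟩
      have h1 := wordValue_le_maxValue (config X ω) origin hA (Finset.mem_filter.2 ⟨hl, hly⟩)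
      have h2 := h.meanValue_le_timeConstant (n := n) (by omega) hA (y := y)
        (fun l hl => mem_words.1 (Finset.mem_filter.1 hl).1)
        (fun l hl => (Finset.mem_filter.1 hl).2)
      simp only [Set.mem_ofPred_eq]
      linarith
    · have : F y = ∅ := by
        refine Set.eq_empty_iff_forall_notMem.2 ?_
        rintro ω ⟨l, hl, hly, -⟩
        exact hA ⟨l, Finset.mem_filter.2 ⟨hl, hly⟩⟩
      rw [this]
      simp only [measureReal_empty]
      positivity
  have hfin : P.real (s n) ≤ (2 * n + 1) * Real.exp (K - 3 / 4 * ε * √n) := by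
    refine (measureReal_mono hsub (measure_ne_top _ _)).trans ((measureReal_biUnion_finset_le _ _).trans ?_)
    refine (Finset.sum_le_sum fun y _ => hF y).trans (le_of_eq ?_)
    rw [Finset.sum_const, Int.card_Icc, nsmul_eq_mul,
      show ((n : ℤ) + 1 - -(n : ℤ)).toNat = 2 * n + 1 by omega]
    push_cast
    rfl
  refine hfin.trans ?_
  have hq0 : 0 < √(n : ℝ) := Real.sqrt_pos.2 (by linarith)
  have hx : 0 < 3 / 4 * ε * √n := by positivity
  have hexp := Real.pow_div_factorial_le_exp _ hx.le 6
  have h6 : (3 / 4 * ε * √(n : ℝ)) ^ 6 = (3 / 4 * ε) ^ 6 * (n : ℝ) ^ 3 := by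
    rw [mul_pow, show √(n : ℝ) ^ 6 = (√(n : ℝ) ^ 2) ^ 3 by ring,
      Real.sq_sqrt (by positivity)]
  rw [h6, show ((Nat.factorial 6 : ℕ) : ℝ) = 720 by norm_num [Nat.factorial]] at hexp
  rw [Real.exp_sub]
  have hle : Real.exp K / Real.exp (3 / 4 * ε * √n) ≤
      Real.exp K / ((3 / 4 * ε) ^ 6 * (n : ℝ) ^ 3 / 720) := by gcongr
  calc (2 * (n : ℝ) + 1) * (Real.exp K / Real.exp (3 / 4 * ε * √n))
      ≤ (3 * n) * (Real.exp K / ((3 / 4 * ε) ^ 6 * (n : ℝ) ^ 3 / 720)) := by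
        refine mul_le_mul (by linarith) hle (by positivity) (by positivity)
    _ = b n := by
        simp only [b]
        field_simp

end IsExpField

/-! ### The lower tail along disjoint tubes -/

/-- The vertex `2 * j` levels above `v`, at the same position. -/
def Vertex.up (v : Vertex) (j : ℕ) : Vertex :=
  Vertex.of v.space (v.level + 2 * j) (by
    obtain ⟨r, hr⟩ := v.even_add
    exact ⟨r + j, by push_cast; omega⟩)

@[simp] theorem Vertex.space_up (v : Vertex) (j : ℕ) : (v.up j).space = v.space := rfl

@[simp] theorem Vertex.level_up (v : Vertex) (j : ℕ) : (v.up j).level = v.level + 2 * j := rfl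

/-- The words allowed in the `j`-th block of a tube: `q` blocks of `2 * k` steps that return to
the axis of the tube, followed by `r` steps to the right. -/
noncomputable def blockWords (k q r j : ℕ) : Finset (List Bool) :=
  if j < q then zeroWords k else {List.replicate r true}

theorem blockWords_nonempty (k q r j : ℕ) : (blockWords k q r j).Nonempty := by
  unfold blockWords
  split_ifs
  · exact zeroWords_nonempty k
  · exact Finset.singleton_nonempty _

theorem length_le_of_mem_blockWords {k q r j : ℕ} (hr : r ≤ 2 * k) {l : List Bool}
    (hl : l ∈ blockWords k q r j) : l.length ≤ 2 * k := by
  unfold blockWords at hl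
  split_ifs at hl
  · exact (length_of_mem_zeroWords hl).le
  · rw [Finset.mem_singleton.1 hl, List.length_replicate]
    exact hr

/-- The maximal value of the `j`-th block of the tube that starts at `v`. -/
noncomputable def blockValue (k q r : ℕ) (w : Edge → ℝ) (v : Vertex) (j : ℕ) : ℝ :=
  maxValue w (v.up (k * j)) (blockWords k q r j) (blockWords_nonempty k q r j)

theorem exists_word_eq_sum_maxValue (w : Edge → ℝ) (v : Vertex) (k q : ℕ) :
    ∃ l : List Bool, l.length = 2 * k * q ∧ displacement l = 0 ∧
      wordValue w v l = ∑ j ∈ Finset.range q,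
        maxValue w (v.up (k * j)) (zeroWords k) (zeroWords_nonempty k) := by
  induction q with
  | zero => exact ⟨[], rfl, rfl, rfl⟩
  | succ q ih =>
    obtain ⟨l, hl, hd, hv⟩ := ih
    obtain ⟨l', hl', e⟩ :=
      exists_wordValue_eq_maxValue w (v.up (k * q)) (zeroWords_nonempty k)
    refine ⟨l ++ l', ?_, ?_, ?_⟩
    · rw [List.length_append, hl, length_of_mem_zeroWords hl']; ring
    · rw [displacement_append, hd, displacement_of_mem_zeroWords hl', add_zero]
    · have hend : endpoint v l = v.up (k * q) :=
        Vertex.eq_of (by rw [space_endpoint, hd, add_zero, Vertex.space_up])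
          (by rw [level_endpoint, hl, Vertex.level_up]; ring)
      rw [wordValue_append, hv, hend, Finset.sum_range_succ, e]

/-- Concatenation of the optimal paths of the blocks of a tube. -/
theorem exists_word_eq_sum_blockValue (w : Edge → ℝ) (v : Vertex) (k q r : ℕ) :
    ∃ l : List Bool, l.length = 2 * k * q + r ∧
      wordValue w v l = ∑ j ∈ Finset.range (q + 1), blockValue k q r w v j := by
  obtain ⟨l, hl, hd, hv⟩ := exists_word_eq_sum_maxValue w v k q
  refine ⟨l ++ List.replicate r true, by rw [List.length_append, hl, List.length_replicate], ?_⟩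
  have hend : endpoint v l = v.up (k * q) :=
    Vertex.eq_of (by rw [space_endpoint, hd, add_zero, Vertex.space_up])
      (by rw [level_endpoint, hl, Vertex.level_up]; ring)
  rw [wordValue_append, hv, hend, Finset.sum_range_succ]
  congr 1
  · refine Finset.sum_congr rfl fun j hj => ?_
    simp only [blockValue, blockWords, if_pos (Finset.mem_range.1 hj)]
  · simp only [blockValue, blockWords, lt_irrefl, if_false, maxValue_singleton]

/-- Blocks of the same tube use different levels; tubes with distant axes use different
vertices. -/
theorem disjoint_edgeSet_blockWords {k q r : ℕ} (hr : r ≤ 2 * k) {v v' : Vertex} {j j' : ℕ}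
    (hlev : v.level = v'.level)
    (hne : j ≠ j' ∨ (4 * k + 1 : ℕ) ≤ |v.space - v'.space|) :
    Disjoint (edgeSet (v.up (k * j)) (blockWords k q r j))
      (edgeSet (v'.up (k * j')) (blockWords k q r j')) := by
  refine Finset.disjoint_left.2 fun e he he' => ?_
  obtain ⟨l, hl, h⟩ := mem_edgeSet.1 he
  obtain ⟨l', hl', h'⟩ := mem_edgeSet.1 he'
  obtain ⟨h1, h2, h3⟩ := mem_wordEdges_bounds h
  obtain ⟨h1', h2', h3'⟩ := mem_wordEdges_bounds h'
  have hlen := length_le_of_mem_blockWords hr hl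
  have hlen' := length_le_of_mem_blockWords hr hl'
  simp only [Vertex.level_up, Vertex.space_up] at h1 h2 h3 h1' h2' h3'
  rcases hne with hne | hne
  · rcases Nat.lt_or_gt_of_ne hne with hlt | hlt
    · have : k * (j + 1) ≤ k * j' := Nat.mul_le_mul_left k hlt
      rw [mul_add, mul_one] at this
      omega
    · have : k * (j' + 1) ≤ k * j := Nat.mul_le_mul_left k hlt
      rw [mul_add, mul_one] at this
      omega
  · have h4 := abs_sub_le v.space e.src.space v'.space
    rw [abs_sub_comm v.space e.src.space] at h4
    have h5 : (l.length : ℤ) ≤ 2 * k := by exact_mod_cast hlen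
    have h6 : (l'.length : ℤ) ≤ 2 * k := by exact_mod_cast hlen'
    push_cast at hne
    linarith

/-- A real random variable with exponential moments satisfies a strict exponential bound below
its mean. -/
theorem exists_mgf_lt_one {Ω : Type*} [MeasurableSpace Ω] {P : Measure Ω}
    [IsProbabilityMeasure P] {Y : Ω → ℝ} {c : ℝ} (hc : 0 < c)
    (hint : ∀ t, |t| ≤ c → Integrable (fun ω => Real.exp (t * Y ω)) P)
    (hpos : 0 < ∫ ω, Y ω ∂P) : ∃ t, 0 < t ∧ t ≤ c ∧ mgf Y P (-t) < 1 := by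
  have h0 : (0 : ℝ) ∈ interior (integrableExpSet Y P) := by
    rw [mem_interior_iff_mem_nhds]
    refine mem_of_superset (Icc_mem_nhds (neg_lt_zero.2 hc) hc) fun t ht => ?_
    exact hint t (abs_le.2 ht)
  have hd : HasDerivAt (mgf Y P) (∫ ω, Y ω ∂P) 0 := by
    have := hasDerivAt_mgf h0
    simpa using this
  have hev : ∀ᶠ t in 𝓝[<] (0 : ℝ), mgf Y P t < mgf Y P 0 := by
    have h1 := (hasDerivAt_iff_tendsto_slope.1 hd).eventually (lt_mem_nhds hpos)
    have h2 : ∀ᶠ t in 𝓝[<] (0 : ℝ), 0 < slope (mgf Y P) 0 t :=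
      h1.filter_mono (nhdsWithin_mono _ fun t ht => ne_of_lt ht)
    filter_upwards [h2, self_mem_nhdsWithin] with t ht ht0
    have ht0' : t < 0 := ht0
    rw [slope_def_field, sub_zero] at ht
    by_contra hcon
    exact absurd ht (not_lt.2 (div_nonpos_of_nonneg_of_nonpos
      (sub_nonneg.2 (not_lt.1 hcon)) ht0'.le))
  have hc' : ∀ᶠ t in 𝓝[<] (0 : ℝ), -c ≤ t ∧ t < 0 := by
    filter_upwards [Ico_mem_nhdsLT (neg_lt_zero.2 hc)] with t ht
    exact ht
  obtain ⟨t, h1, h2, h3⟩ := (hev.and hc').exists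
  refine ⟨-t, by linarith, by linarith, ?_⟩
  rw [neg_neg]
  simpa [mgf_zero] using h1

/-- The Chernoff bound for the event that a sum of independent variables is non-positive. -/
theorem measureReal_sum_nonpos_le {Ω ι : Type*} [MeasurableSpace Ω] {P : Measure Ω}
    [Fintype ι] {Y : ι → Ω → ℝ} (hY : ∀ i, Measurable (Y i)) (hind : iIndepFun Y P) {t : ℝ}
    (ht : 0 ≤ t) (hint : ∀ i, Integrable (fun ω => Real.exp (-t * Y i ω)) P) :
    P.real {ω | ∑ i, Y i ω ≤ 0} ≤ ∏ i, mgf (Y i) P (-t) := by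
  have := hind.isProbabilityMeasure
  have h1 := hind.integrable_exp_mul_sum (s := Finset.univ) hY (fun i _ => hint i)
  have h2 := measure_le_le_exp_mul_mgf (μ := P) 0 (neg_nonpos.2 ht) h1
  rw [hind.mgf_sum hY] at h2
  simpa using h2

namespace IsExpField

variable {Ω : Type*} [MeasurableSpace Ω] {P : Measure Ω} {X : Edge → Ω → ℝ} {c : ℝ}

theorem iIndepFun_maxValue (h : IsExpField P X c) {ι : Type*} (v : ι → Vertex)
    (A : ι → Finset (List Bool)) (hA : ∀ i, (A i).Nonempty)
    (hdisj : ∀ i j, i ≠ j → Disjoint (edgeSet (v i) (A i)) (edgeSet (v j) (A j))) :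
    iIndepFun (fun i ω => maxValue (config X ω) (v i) (A i) (hA i)) P := by
  classical
  let S : ι → Set Edge := fun i => ↑(edgeSet (v i) (A i))
  have hS : Pairwise (Function.onFun Disjoint S) := fun i j hij =>
    Finset.disjoint_coe.2 (hdisj i j hij)
  have h1 := iIndepFun_restrict_of_disjoint h.meas h.indep hS
  have h2 := h1.comp (fun i (r : S i → ℝ) =>
    maxValue (fun e => if he : e ∈ S i then r ⟨e, he⟩ else 0) (v i) (A i) (hA i)) (fun i => by
      refine (DirectedLattice.measurable_maxValue _ _ _).comp (measurable_pi_iff.2 fun e => ?_)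
      split_ifs <;> fun_prop)
  convert h2 using 2 with i
  ext ω
  refine maxValue_congr fun e he => ?_
  have he' : e ∈ S i := Finset.mem_coe.2 he
  simp [he', config]

theorem mgf_wordValue_replicate_le (h : IsExpField P X c) {r k : ℕ} (hr : r ≤ k) (v : Vertex)
    {t : ℝ} (ht : |t| ≤ c) :
    mgf (fun ω => wordValue (config X ω) v (List.replicate r true)) P t ≤
      expMoment P X c ^ k := by
  have h1 := h.integral_exp_sum (edgeSet v {List.replicate r true})
  rw [card_edgeSet_singleton, List.length_replicate] at h1
  refine le_trans ?_ (h1.le.trans (pow_le_pow_right₀ h.one_le_expMoment hr))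
  have hle : ∀ ω, |wordValue (config X ω) v (List.replicate r true)| ≤
      ∑ e ∈ edgeSet v {List.replicate r true}, |X e ω| := fun ω =>
    abs_wordValue_le (config X ω) (Finset.mem_singleton_self _)
  refine integral_mono (h.integrable_exp_of_abs_le (h.measurable_wordValue _ _) _ hle ht)
    (h.integrable_exp_sum _) fun ω => Real.exp_le_exp.2 ?_
  refine (le_abs_self _).trans ?_
  rw [abs_mul]
  exact mul_le_mul ht (hle ω) (abs_nonneg _) h.pos.le

/-- If the starting points in `S` lie on one level, far apart from each other, then the tubes above
them are independent, and the probability that the block values of every tube add up to at most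
`q * b` factorizes. -/
theorem measureReal_forall_sum_blockValue_le (h : IsExpField P X c) {k q r : ℕ}
    (hr : r ≤ 2 * k) {b t : ℝ} (ht : 0 ≤ t) (htc : t ≤ c) (m : ℕ) (S : Finset Vertex)
    (hlev : ∀ v ∈ S, v.level = m)
    (hsep : ∀ v ∈ S, ∀ v' ∈ S, v ≠ v' → (4 * k + 1 : ℕ) ≤ |v.space - v'.space|) :
    P.real {ω | ∀ v ∈ S, ∑ j ∈ Finset.range (q + 1), blockValue k q r (config X ω) v j ≤ q * b} ≤
      (mgf (fun ω => maxValue (config X ω) origin (zeroWords k) (zeroWords_nonempty k) - b) P (-t)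
        ^ q * expMoment P X c ^ (2 * k)) ^ S.card := by
  have := h.isProbabilityMeasure
  have htabs : |(-t)| ≤ c := by rwa [abs_neg, abs_of_nonneg ht]
  set φ := mgf (fun ω => maxValue (config X ω) origin (zeroWords k)
    (zeroWords_nonempty k) - b) P (-t) with hφ
  let B : S × Fin (q + 1) → Ω → ℝ := fun p ω => blockValue k q r (config X ω) p.1 p.2
  have hB : iIndepFun B P := by
    refine h.iIndepFun_maxValue (fun p : S × Fin (q + 1) => (p.1 : Vertex).up (k * p.2)) _ _ ?_
    intro p p' hpp
    refine disjoint_edgeSet_blockWords hr ((hlev _ p.1.2).trans (hlev _ p'.1.2).symm) ?_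
    by_contra hcon
    rw [not_or, not_not] at hcon
    have h1 : p.1 = p'.1 := by
      by_contra hne
      exact hcon.2 (hsep _ p.1.2 _ p'.1.2 fun heq => hne (Subtype.ext heq))
    exact hpp (Prod.ext h1 (Fin.ext hcon.1))
  let d : Fin (q + 1) → ℝ := fun j => if (j : ℕ) < q then b else 0
  let Y : S × Fin (q + 1) → Ω → ℝ := fun p ω => B p ω - d p.2
  have hBm : ∀ p, Measurable (B p) := fun p => h.measurable_maxValue _ _ _
  have hYm : ∀ p, Measurable (Y p) := fun p => (hBm p).sub_const _
  have hY : iIndepFun Y P := hB.comp (fun p x => x - d p.2) fun p => by fun_prop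
  have hYint : ∀ p, Integrable (fun ω => Real.exp (-t * Y p ω)) P := fun p => by
    simp only [Y, mul_sub, sub_eq_add_neg (_ * B p _), Real.exp_add]
    exact (h.integrable_exp_maxValue _ _ _ htabs).mul_const _
  have hsub : {ω | ∀ v ∈ S, ∑ j ∈ Finset.range (q + 1),
      blockValue k q r (config X ω) v j ≤ q * b} ⊆ {ω | ∑ p, Y p ω ≤ 0} := by
    intro ω hω
    have hd : ∑ j : Fin (q + 1), d j = q * b := by
      rw [Fin.sum_univ_castSucc]
      simp [d]
    simp only [Set.mem_ofPred_eq, Fintype.sum_prod_type]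
    refine Finset.sum_nonpos fun v _ => ?_
    simp only [Y, Finset.sum_sub_distrib, hd, B]
    have h1 := hω v v.2
    rw [Finset.sum_range] at h1
    linarith
  refine (measureReal_mono hsub (measure_ne_top _ _)).trans
    ((measureReal_sum_nonpos_le hYm hY ht hYint).trans ?_)
  have hmain : ∀ (v : S) (j : Fin q), mgf (Y (v, j.castSucc)) P (-t) = φ := by
    intro v j
    have h1 : Y (v, j.castSucc) = fun ω => maxValue (config X ω)
        ((v : Vertex).up (k * j)) (zeroWords k) (zeroWords_nonempty k) - b := by
      ext ω
      simp [Y, B, d, blockValue, blockWords]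
    have h2 := ((h.identDistrib_maxValue ((v : Vertex).up (k * j)) (zeroWords k)
      (zeroWords_nonempty k)).comp (u := fun x => Real.exp (-t * (x - b)))
      (by fun_prop)).integral_eq
    rw [h1, hφ]
    exact h2
  have hlast : ∀ v : S, mgf (Y (v, Fin.last q)) P (-t) ≤ expMoment P X c ^ (2 * k) := by
    intro v
    have h1 : Y (v, Fin.last q) = fun ω => wordValue (config X ω)
        ((v : Vertex).up (k * q)) (List.replicate r true) := by
      ext ω
      simp [Y, B, d, blockValue, blockWords, maxValue_singleton]
    rw [h1]
    exact h.mgf_wordValue_replicate_le hr _ htabs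
  rw [Fintype.prod_prod_type]
  calc ∏ v : S, ∏ j : Fin (q + 1), mgf (Y (v, j)) P (-t)
      ≤ ∏ _v : S, (φ ^ q * expMoment P X c ^ (2 * k)) := by
        refine Finset.prod_le_prod (fun v _ => Finset.prod_nonneg fun j _ => mgf_nonneg)
          fun v _ => ?_
        rw [Fin.prod_univ_castSucc]
        simp only [hmain, Finset.prod_const, Finset.card_univ, Fintype.card_fin]
        exact mul_le_mul_of_nonneg_left (hlast v) (pow_nonneg mgf_nonneg _)
    _ = _ := by simp

/-- For starting points on one level that are far apart, the events that the best path of length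
`L` has less than the typical value are jointly as unlikely as independent events of probability
`exp (-κ L)`. -/
theorem exists_measure_forall_wordValue_lt_le (h : IsExpField P X c) {η : ℝ} (hη : 0 < η) :
    ∃ (D : ℕ) (κ : ℝ) (L₀ : ℕ), 0 < D ∧ 0 < κ ∧ ∀ L, L₀ ≤ L → ∀ (m : ℕ) (S : Finset Vertex),
      (∀ v ∈ S, v.level = m) →
      (∀ v ∈ S, ∀ v' ∈ S, v ≠ v' → (D : ℤ) ≤ |v.space - v'.space|) →
      P.real {ω | ∀ v ∈ S, ∀ l : List Bool, l.length = L →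
        wordValue (config X ω) v l < (timeConstant P X - η) * L} ≤
        Real.exp (-(κ * L * S.card)) := by
  have := h.isProbabilityMeasure
  set μ := timeConstant P X with hμ
  obtain ⟨k, hk, hmean⟩ := exists_lt_meanValue P X (show 0 < η / 4 by positivity)
  have hk0 : (0 : ℝ) < k := by exact_mod_cast hk
  set b : ℝ := (μ - η / 2) * (2 * k) with hb
  have hpos : 0 < ∫ ω, (maxValue (config X ω) origin (zeroWords k) (zeroWords_nonempty k) - b)
      ∂P := by
    rw [integral_sub (h.integrable_maxValue _ _ _) (integrable_const _)]
    have h1 : ∫ ω, maxValue (config X ω) origin (zeroWords k) (zeroWords_nonempty k) ∂P =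
      meanValue P X (zeroWords k) (zeroWords_nonempty k) := rfl
    have h2 : b < (μ - η / 4) * (2 * k) :=
      mul_lt_mul_of_pos_right (by linarith) (by positivity)
    rw [h1]
    simp only [integral_const, probReal_univ, one_smul]
    linarith
  have hint : ∀ t, |t| ≤ c → Integrable (fun ω => Real.exp (t *
      (maxValue (config X ω) origin (zeroWords k) (zeroWords_nonempty k) - b))) P := by
    intro t ht
    simp only [mul_sub, sub_eq_add_neg (_ * maxValue _ _ _ _), Real.exp_add]
    exact (h.integrable_exp_maxValue _ _ _ ht).mul_const _
  obtain ⟨t, ht0, htc, hφ1⟩ := exists_mgf_lt_one h.pos hint hpos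
  set φ := mgf (fun ω => maxValue (config X ω) origin (zeroWords k)
    (zeroWords_nonempty k) - b) P (-t) with hφ
  have hφ0 : 0 < φ := mgf_pos (hint (-t) (by rwa [abs_neg, abs_of_pos ht0]))
  have hM := h.one_le_expMoment
  set ρ := -Real.log φ with hρ
  have hρ0 : 0 < ρ := neg_pos.2 (Real.log_neg hφ0 hφ1)
  set R := 2 * k * Real.log (expMoment P X c) + ρ with hR
  refine ⟨4 * k + 1, ρ / (4 * k), ⌈R * (4 * k) / ρ⌉₊ + ⌈4 * k * |μ - η / 2| / η⌉₊,
    by omega, by positivity, fun L hL m S hlev hsep => ?_⟩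
  have hL1 : R * (4 * k) / ρ ≤ L := (Nat.le_ceil _).trans (by
    exact_mod_cast (Nat.le_add_right _ _).trans hL)
  have hL2 : 4 * k * |μ - η / 2| / η ≤ L := (Nat.le_ceil _).trans (by
    exact_mod_cast (Nat.le_add_left _ _).trans hL)
  rw [div_le_iff₀ hρ0] at hL1
  rw [div_le_iff₀ hη] at hL2
  set q := L / (2 * k) with hq
  set r := L % (2 * k) with hr
  have hLqr : 2 * k * q + r = L := Nat.div_add_mod L (2 * k)
  have hr2 : r < 2 * k := Nat.mod_lt _ (by omega)
  have hLqr' : 2 * (k : ℝ) * q + r = L := by exact_mod_cast hLqr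
  have hr2' : (r : ℝ) ≤ 2 * k := by exact_mod_cast hr2.le
  have hqb : (μ - η) * L ≤ q * b := by
    have h1 : q * b = (μ - η / 2) * L - (μ - η / 2) * r := by
      rw [hb, ← hLqr']; ring
    have h2 : (μ - η / 2) * r ≤ |μ - η / 2| * (2 * k) :=
      mul_le_mul (le_abs_self _) hr2' (by positivity) (abs_nonneg _)
    rw [h1]
    nlinarith
  have hsub : {ω | ∀ v ∈ S, ∀ l : List Bool, l.length = L →
      wordValue (config X ω) v l < (μ - η) * L} ⊆
      {ω | ∀ v ∈ S, ∑ j ∈ Finset.range (q + 1),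
        blockValue k q r (config X ω) v j ≤ q * b} := by
    intro ω hω v hv
    obtain ⟨l, hl, e⟩ := exists_word_eq_sum_blockValue (config X ω) v k q r
    rw [← e]
    exact (hω v hv l (hl.trans hLqr)).le.trans hqb
  refine (measureReal_mono hsub (measure_ne_top _ _)).trans
    ((h.measureReal_forall_sum_blockValue_le hr2.le ht0.le htc m S hlev hsep).trans ?_)
  have hexp : φ ^ q * expMoment P X c ^ (2 * k) ≤ Real.exp (-(ρ / (4 * k) * L)) := by
    have h1 : φ = Real.exp (-ρ) := by rw [hρ, neg_neg, Real.exp_log hφ0]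
    have h2 : expMoment P X c = Real.exp (Real.log (expMoment P X c)) :=
      (Real.exp_log (by linarith)).symm
    rw [h2, h1, ← Real.exp_nat_mul, ← Real.exp_nat_mul, ← Real.exp_add]
    refine Real.exp_le_exp.2 ?_
    have h3 : (L : ℝ) / (2 * k) ≤ q + 1 := by
      rw [div_le_iff₀ (by positivity)]
      linarith
    have h4 : R ≤ ρ * L / (4 * k) := by
      rw [le_div_iff₀ (by positivity)]
      linarith
    have h5 := mul_le_mul_of_nonneg_left h3 hρ0.le
    have h6 : ρ * (L / (2 * k)) = ρ * L / (4 * k) + ρ / (4 * k) * L := by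
      field_simp
      ring
    push_cast
    linarith
  refine (pow_le_pow_left₀ (mul_nonneg (pow_nonneg hφ0.le _) (by positivity)) hexp _).trans
    (le_of_eq ?_)
  rw [← Real.exp_nat_mul]
  congr 1
  ring

end IsExpField

/-! ### Vertices of a block -/

theorem finite_block (m : ℕ) (r : ℝ) : (block m r).Finite := by
  refine Set.Finite.of_finite_image (f := Vertex.space)
    ((Set.finite_Icc (-⌈r⌉) ⌈r⌉).subset ?_) ?_
  · rintro _ ⟨v, ⟨-, h1, h2⟩, rfl⟩
    have h3 := Int.le_ceil r
    refine ⟨?_, ?_⟩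
    · have : ((-⌈r⌉ : ℤ) : ℝ) ≤ v.space := by push_cast; linarith
      exact_mod_cast this
    · have : (v.space : ℝ) ≤ (⌈r⌉ : ℤ) := by linarith
      exact_mod_cast this
  · intro v hv v' hv' heq
    exact Vertex.eq_of heq (hv.1.trans hv'.1.symm)

theorem le_ncard_block (m : ℕ) {r : ℝ} (hr : 0 < r) : r / 4 - 1 ≤ ((block m r).ncard : ℝ) := by
  let f : ℕ → Vertex := fun j => Vertex.of (2 * j + (m % 2 : ℕ)) m (by
    refine ⟨j + (m % 2 : ℕ) + (m / 2 : ℕ), ?_⟩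
    have : m % 2 + 2 * (m / 2) = m := Nat.mod_add_div m 2
    omega)
  have hf : Function.Injective f := by
    intro i j hij
    have h1 : (2 * i + (m % 2 : ℕ) : ℤ) = 2 * j + (m % 2 : ℕ) := congrArg Vertex.space hij
    omega
  have hsub : f '' ↑(Finset.range ⌊r / 4⌋₊) ⊆ block m r := by
    rintro _ ⟨j, hj, rfl⟩
    have h1 : j + 1 ≤ ⌊r / 4⌋₊ := Finset.mem_range.1 (Finset.mem_coe.1 hj)
    have h2 : ((j : ℝ) + 1) ≤ r / 4 := by
      refine le_trans ?_ (Nat.floor_le (by positivity))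
      exact_mod_cast h1
    have h3 : ((m % 2 : ℕ) : ℝ) ≤ 1 := by
      have : m % 2 ≤ 1 := by omega
      exact_mod_cast this
    have h4 : ((f j).space : ℝ) = 2 * j + (m % 2 : ℕ) := by
      change ((2 * j + (m % 2 : ℕ) : ℤ) : ℝ) = _
      push_cast
      rfl
    refine ⟨rfl, ?_, ?_⟩
    · rw [h4]
      have : (0 : ℝ) ≤ 2 * j + (m % 2 : ℕ) := by positivity
      linarith
    · rw [h4]
      linarith
  have h1 := Set.ncard_le_ncard hsub (finite_block m r)
  rw [Set.ncard_image_of_injective _ hf, Set.ncard_coe_finset, Finset.card_range] at h1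
  have h2 : r / 4 - 1 ≤ ⌊r / 4⌋₊ := (Nat.sub_one_lt_floor (r / 4)).le
  exact h2.trans (by exact_mod_cast h1)

/-- Among finitely many vertices, a proportion of `1 / D` have mutual distance at least `D`. -/
theorem exists_separated_subset (B : Finset Vertex) {m D : ℕ} (hD : 0 < D)
    (hB : ∀ v ∈ B, v.level = m) :
    ∃ S ⊆ B, (B.card : ℝ) / D ≤ S.card ∧
      ∀ v ∈ S, ∀ v' ∈ S, v ≠ v' → (D : ℤ) ≤ |v.space - v'.space| := by
  classical
  have hD' : (0 : ℤ) < D := by exact_mod_cast hD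
  have hmaps : ∀ v ∈ B, v.space % D ∈ Finset.Ico (0 : ℤ) D := fun v _ =>
    Finset.mem_Ico.2 ⟨Int.emod_nonneg _ hD'.ne', Int.emod_lt_of_pos _ hD'⟩
  obtain ⟨a, -, ha⟩ := Finset.exists_le_card_fiber_of_nsmul_le_card_of_maps_to
    (b := (B.card : ℝ) / D) hmaps ⟨0, Finset.mem_Ico.2 ⟨le_rfl, hD'⟩⟩ (by
      rw [Int.card_Ico, nsmul_eq_mul]
      simp only [sub_zero, Int.toNat_natCast]
      rw [mul_div_cancel₀]
      exact_mod_cast hD.ne')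
  refine ⟨B.filter fun v => v.space % D = a, Finset.filter_subset _ _, ha, ?_⟩
  intro v hv v' hv' hne
  obtain ⟨hvB, hva⟩ := Finset.mem_filter.1 hv
  obtain ⟨hvB', hva'⟩ := Finset.mem_filter.1 hv'
  have hdvd : (D : ℤ) ∣ v.space - v'.space :=
    Int.ModEq.dvd (show v'.space % D = v.space % D from hva'.trans hva.symm)
  have hne' : v.space - v'.space ≠ 0 := fun h0 =>
    hne (Vertex.eq_of (sub_eq_zero.1 h0) ((hB v hvB).trans (hB v' hvB').symm))
  exact Int.le_of_dvd (abs_pos.2 hne') ((dvd_abs _ _).2 hdvd)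

/-- If less than nine tenths of the block are good starting points, then at least a fixed
proportion of the block consists of bad starting points that are far apart. -/
theorem exists_separated_of_notMem_goodEvent {Ω : Type*} {X : Edge → Ω → ℝ} {D : ℕ}
    (hD : 0 < D) {μ ε δ : ℝ} {n : ℕ} {ω : Ω}
    (hω : ω ∉ goodEvent X μ ε δ n) :
    ∃ S : Finset Vertex, S ⊆ (finite_block ⌊δ * n⌋₊ (δ * n / 4)).toFinset ∧
      ((block ⌊δ * n⌋₊ (δ * n / 4)).ncard : ℝ) / (10 * D) ≤ S.card ∧
      (∀ v ∈ S, ∀ v' ∈ S, v ≠ v' → (D : ℤ) ≤ |v.space - v'.space|) ∧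
      ∀ v ∈ S, ∀ l : List Bool, l.length = n - ⌊δ * n⌋₊ →
        wordValue (config X ω) v l < (μ - ε / 10) * (1 - δ) * n := by
  classical
  set B := block ⌊δ * n⌋₊ (δ * n / 4) with hB
  have hfin : B.Finite := finite_block _ _
  set G := goodStarts (config X ω) μ ε δ n with hG
  have hGB : G ⊆ B := fun v hv => hv.1
  have hcard : (G.ncard : ℝ) < 9 / 10 * B.ncard := not_le.1 hω
  have hdiff : (B \ G).Finite := hfin.subset Set.sdiff_subset
  have hadd : ((B \ G).ncard : ℝ) + G.ncard = B.ncard := by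
    exact_mod_cast Set.ncard_sdiff_add_ncard_of_subset hGB hfin
  obtain ⟨S, hS, hSc, hsep⟩ := exists_separated_subset hdiff.toFinset hD
    (m := ⌊δ * n⌋₊) fun v hv => ((Set.Finite.mem_toFinset _).1 hv).1.1
  rw [← Set.ncard_eq_toFinset_card _ hdiff] at hSc
  have hD' : (0 : ℝ) < D := by exact_mod_cast hD
  refine ⟨S, fun v hv => ?_, ?_, hsep, fun v hv l hl => ?_⟩
  · exact (Set.Finite.mem_toFinset _).2 ((Set.Finite.mem_toFinset _).1 (hS hv)).1
  · refine le_trans ?_ hSc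
    rw [div_le_div_iff₀ (by positivity) hD']
    nlinarith
  · obtain ⟨hvB, hvG⟩ := (Set.Finite.mem_toFinset _).1 (hS hv)
    by_contra hcon
    refine hvG ⟨hvB, ?_⟩
    refine (exists_mem_pathsTo_iff _ v n
      (fun x => (μ - ε / 10) * (1 - δ) * n ≤ x)).2 ⟨l, ?_, not_lt.1 hcon⟩
    rw [hvB.1, hl]

/-! ### The law of large numbers and the good starting points -/

namespace IsExpField

variable {Ω : Type*} [MeasurableSpace Ω] {P : Measure Ω} {X : Edge → Ω → ℝ} {c : ℝ}

theorem ae_eventually_le_lastPassage (h : IsExpField P X c) {η : ℝ} (hη : 0 < η) :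
    ∀ᵐ ω ∂P, ∀ᶠ n : ℕ in atTop,
      (timeConstant P X - η) * n ≤ lastPassage (config X ω) n := by
  have := h.isProbabilityMeasure
  obtain ⟨D, κ, L₀, hD, hκ, hbound⟩ := h.exists_measure_forall_wordValue_lt_le hη
  let s : ℕ → Set Ω := fun n =>
    {ω | lastPassage (config X ω) n < (timeConstant P X - η) * n}
  suffices hs : ∀ᵐ ω ∂P, ∀ᶠ n in atTop, ω ∉ s n by
    filter_upwards [hs] with ω hω
    filter_upwards [hω] with n hn
    exact not_lt.1 hn
  have hsum : Summable fun n : ℕ => Real.exp (n * (-κ)) :=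
    Real.summable_exp_nat_mul_iff.2 (neg_lt_zero.2 hκ)
  refine ae_eventually_notMem_of_le hsum (n₀ := L₀) fun n hn => ?_
  have h1 := hbound n hn 0 {origin} (by simp; rfl) (by simp)
  rw [Finset.card_singleton, Nat.cast_one, mul_one,
    show -(κ * n) = n * (-κ) by ring] at h1
  refine (measureReal_mono ?_ (measure_ne_top _ _)).trans h1
  intro ω hω v hv l hl
  rw [Finset.mem_singleton.1 hv]
  refine lt_of_le_of_lt ?_ hω
  rw [lastPassage_eq_maxValue]
  exact wordValue_le_maxValue _ _ _ (mem_words.2 hl)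

/-- The law of large numbers for the passage time. -/
theorem ae_tendsto_lastPassage_div (h : IsExpField P X c) :
    ∀ᵐ ω ∂P, Tendsto (fun n : ℕ => lastPassage (config X ω) n / (n : ℝ)) atTop
      (𝓝 (timeConstant P X)) := by
  have hk : ∀ k : ℕ, (0 : ℝ) < 1 / ((k : ℝ) + 1) := fun k => Nat.one_div_pos_of_nat
  have hk1 : ∀ k : ℕ, 1 / ((k : ℝ) + 1) ≤ 1 := fun k => by
    rw [div_le_one (by positivity)]
    linarith [(Nat.cast_nonneg k : (0 : ℝ) ≤ k)]
  have hup := ae_all_iff.2 fun k : ℕ => h.ae_eventually_lastPassage_lt (hk k) (hk1 k)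
  have hlow := ae_all_iff.2 fun k : ℕ => h.ae_eventually_le_lastPassage (hk k)
  filter_upwards [hup, hlow] with ω h1 h2
  refine Metric.tendsto_nhds.2 fun ε hε => ?_
  obtain ⟨k, hkε⟩ := exists_nat_one_div_lt hε
  filter_upwards [h1 k, h2 k, eventually_gt_atTop 0] with n hn1 hn2 hn
  have hn' : (0 : ℝ) < n := by exact_mod_cast hn
  rw [Real.dist_eq, abs_lt]
  have h3 := (div_lt_iff₀ hn').2 hn1
  have h4 := (le_div_iff₀ hn').2 hn2
  constructor <;> linarith

/-- A union bound over the subsets of the block: their number `2 ^ O(n)` is negligible against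
`exp (-c n²)`. -/
theorem exists_measure_compl_goodEvent_le (h : IsExpField P X c) {ε δ : ℝ} (hε : 0 < ε)
    (hδ : 0 < δ) (hδ1 : δ < 1) :
    ∃ n₀ : ℕ, ∃ a : ℝ, 0 < a ∧ ∀ n : ℕ, n₀ ≤ n →
      P.real (goodEvent X (timeConstant P X) ε δ n)ᶜ ≤ Real.exp (-a * (n : ℝ) ^ 2) := by
  classical
  have := h.isProbabilityMeasure
  set μ := timeConstant P X with hμ
  obtain ⟨D, κ, L₀, hD, hκ, hbound⟩ :=
    h.exists_measure_forall_wordValue_lt_le (show 0 < ε / 20 by positivity)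
  have hD' : (0 : ℝ) < D := by exact_mod_cast hD
  have hδ' : 0 < 1 - δ := by linarith
  set a := κ * (1 - δ) / (20 * D) with ha
  have ha0 : 0 < a := by positivity
  have hlarge : ∀ᶠ n : ℕ in atTop, (L₀ : ℝ) ≤ (1 - δ) * n ∧
      |μ - ε / 20| ≤ ε / 20 * (1 - δ) * n ∧ 1 ≤ a * n ∧ 1 ≤ δ / 32 * n := by
    have hlin : ∀ C : ℝ, ∀ s : ℝ, 0 < s → ∀ᶠ n : ℕ in atTop, C ≤ s * n := fun C s hs =>
      (tendsto_natCast_atTop_atTop.const_mul_atTop hs).eventually_ge_atTop C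
    filter_upwards [hlin L₀ _ hδ', hlin |μ - ε / 20| (ε / 20 * (1 - δ)) (by positivity),
      hlin 1 a ha0, hlin 1 (δ / 32) (by positivity)] with n h1 h2 h3 h4
    exact ⟨h1, h2, h3, h4⟩
  obtain ⟨n₀, hn₀⟩ := eventually_atTop.1 hlarge
  refine ⟨n₀, δ / 32 * a, by positivity, fun n hn => ?_⟩
  obtain ⟨hL, hslack, han, hδn⟩ := hn₀ n hn
  have hn0 : (0 : ℝ) < n := by
    rcases Nat.eq_zero_or_pos n with rfl | hpos
    · norm_num at hδn
    · exact_mod_cast hpos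
  set m := ⌊δ * n⌋₊ with hm
  have hm1 : (m : ℝ) ≤ δ * n := Nat.floor_le (by positivity)
  have hm2 : δ * n < m + 1 := Nat.lt_floor_add_one _
  have hmn : m ≤ n := by
    have : (m : ℝ) ≤ n := by nlinarith
    exact_mod_cast this
  have hcast : ((n - m : ℕ) : ℝ) = n - m := Nat.cast_sub hmn
  have hL₀ : L₀ ≤ n - m := by
    have : (L₀ : ℝ) ≤ ((n - m : ℕ) : ℝ) := by rw [hcast]; linarith
    exact_mod_cast this
  set B := block m (δ * n / 4) with hB
  have hfin : B.Finite := finite_block _ _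
  set N : ℝ := (B.ncard : ℝ) with hN
  have hNlow : δ / 32 * n ≤ N := by
    have := le_ncard_block m (r := δ * n / 4) (by positivity)
    rw [← hB, ← hN] at this
    linarith
  -- The threshold in terms of the actual number `n - m` of steps, which exceeds `(1 - δ) n` by
  -- less than one.
  have hthr : (μ - ε / 10) * (1 - δ) * n ≤ (μ - ε / 20) * ((n - m : ℕ) : ℝ) := by
    have h1 : -|μ - ε / 20| ≤ (μ - ε / 20) * (δ * n - m) := by
      have h2 : |(μ - ε / 20) * (δ * n - m)| ≤ |μ - ε / 20| * 1 := by
        rw [abs_mul]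
        refine mul_le_mul_of_nonneg_left ?_ (abs_nonneg _)
        rw [abs_le]
        constructor <;> linarith
      linarith [(abs_le.1 h2).1]
    rw [hcast]
    linarith
  let 𝒮 := hfin.toFinset.powerset.filter fun S : Finset Vertex => N / (10 * D) ≤ S.card ∧
    ∀ v ∈ S, ∀ v' ∈ S, v ≠ v' → (D : ℤ) ≤ |v.space - v'.space|
  let F : Finset Vertex → Set Ω := fun S => {ω | ∀ v ∈ S, ∀ l : List Bool, l.length = n - m →
    wordValue (config X ω) v l < (μ - ε / 20) * ((n - m : ℕ) : ℝ)}
  have hsub : (goodEvent X μ ε δ n)ᶜ ⊆ ⋃ S ∈ 𝒮, F S := by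
    intro ω hω
    obtain ⟨S, hSB, hSc, hsep, hbad⟩ := exists_separated_of_notMem_goodEvent hD hω
    refine Set.mem_biUnion (x := S) (Finset.mem_coe.2 (Finset.mem_filter.2
      ⟨Finset.mem_powerset.2 hSB, hSc, hsep⟩)) fun v hv l hl => ?_
    exact (hbad v hv l hl).trans_le hthr
  have hF : ∀ S ∈ 𝒮, P.real (F S) ≤ Real.exp (-(2 * a * n * N)) := by
    intro S hS
    obtain ⟨hSB, hSc, hsep⟩ := Finset.mem_filter.1 hS
    refine (hbound (n - m) hL₀ m S (fun v hv => ?_) hsep).trans (Real.exp_le_exp.2 ?_)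
    · exact ((Set.Finite.mem_toFinset _).1 (Finset.mem_powerset.1 hSB hv)).1
    · have h1 : (1 - δ) * n ≤ ((n - m : ℕ) : ℝ) := by rw [hcast]; linarith
      have h2 : 2 * a * n * N = κ * ((1 - δ) * n) * (N / (10 * D)) := by
        rw [ha]; field_simp; ring
      rw [h2, neg_le_neg_iff]
      gcongr
  have hcard : (𝒮.card : ℝ) ≤ Real.exp N := by
    have h1 : 𝒮.card ≤ 2 ^ B.ncard := by
      refine (Finset.card_filter_le _ _).trans ?_
      rw [Finset.card_powerset, Set.ncard_eq_toFinset_card B hfin]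
    have h2 : (𝒮.card : ℝ) ≤ 2 ^ B.ncard := by exact_mod_cast h1
    have h3 : (2 : ℝ) ≤ Real.exp 1 := by linarith [Real.add_one_le_exp 1]
    refine h2.trans ((pow_le_pow_left₀ (by norm_num) h3 _).trans (le_of_eq ?_))
    rw [← Real.exp_nat_mul, mul_one]
  refine (measureReal_mono hsub (measure_ne_top _ _)).trans
    ((measureReal_biUnion_finset_le _ _).trans ((Finset.sum_le_sum hF).trans ?_))
  rw [Finset.sum_const, nsmul_eq_mul]
  refine (mul_le_mul_of_nonneg_right hcard (Real.exp_pos _).le).trans ?_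
  rw [← Real.exp_add]
  refine Real.exp_le_exp.2 ?_
  have hN0 : 0 ≤ N := Nat.cast_nonneg _
  have h1 : N ≤ a * n * N := le_mul_of_one_le_left hN0 han
  have h2 : δ / 32 * a * (n : ℝ) ^ 2 ≤ a * n * N := by
    calc δ / 32 * a * (n : ℝ) ^ 2 = a * n * (δ / 32 * n) := by ring
      _ ≤ a * n * N := by gcongr
  linarith

end IsExpField

end DirectedLattice

theorem proposition2p1 {Ω : Type*} [MeasurableSpace Ω] (P : Measure Ω) [IsProbabilityMeasure P]
    (X : DirectedLattice.Edge → Ω → ℝ)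
    (hmeas : ∀ e, Measurable (X e))
    (hindep : iIndepFun X P)
    (hident : ∀ e e', IdentDistrib (X e) (X e') P P)
    (hmean : ∀ e, ∫ ω, X e ω ∂P = 0)
    (hcramer : ∃ c₀ : ℝ, 0 < c₀ ∧ ∀ c : ℝ, |c| < c₀ →
      ∀ e, Integrable (fun ω => Real.exp (c * X e ω)) P) :
    ∃ μ : ℝ,
      (∀ᵐ ω ∂P, Tendsto
        (fun n : ℕ => DirectedLattice.lastPassage (fun e => X e ω) n / (n : ℝ)) atTop (𝓝 μ)) ∧
      ∃ ε₀ : ℝ, 0 < ε₀ ∧ ∀ ε : ℝ, 0 < ε → ε < ε₀ → ∀ δ : ℝ, 0 < δ → δ < 1 →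
        ∃ n₀ : ℕ, ∃ c : ℝ, 0 < c ∧ ∀ n : ℕ, n₀ ≤ n →
          P.real (DirectedLattice.goodEvent X μ ε δ n)ᶜ ≤ Real.exp (-c * (n : ℝ) ^ 2) := by
  obtain ⟨c₀, hc₀, hint⟩ := hcramer
  have h : DirectedLattice.IsExpField P X (c₀ / 2) :=
    { pos := by positivity
      meas := hmeas
      indep := hindep
      ident := hident
      integrable := fun e => by
        have hlt : |c₀ / 2| < c₀ := by rw [abs_of_pos (by positivity)]; linarith
        have h1 := integrable_exp_mul_abs (hint (c₀ / 2) hlt e)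
          (hint (-(c₀ / 2)) (by rwa [abs_neg]) e)
        exact h1 }
  exact ⟨DirectedLattice.timeConstant P X, h.ae_tendsto_lastPassage_div, 1, one_pos,
    fun ε hε _ δ hδ hδ1 => h.exists_measure_compl_goodEvent_le hε hδ hδ1⟩
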